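/- Theorem 4.3 (Residue Form of the Conformable Inversion Formula). Let $\alpha>0$, $a\in\mathbb R$, and let $f:[0,\infty)\to\mathbb R$ be piecewise continuous (on every bounded interval $f$ has only finitely many discontinuities, and finite one-sided limits exist everywhere) and of conformable exponential order $a$, i.e. $|f(t)|\le M e^{a t^\alpha/\alpha}$ for all $t\ge 0$ and some constant $M$. Let $$F_\alpha(s)=\int_0^\infty e^{-s t^\alpha/\alpha} f(t)\,t^{\alpha-1}\,dt,\qquad \operatorname{Re}(s)>a .$$ (1) Suppose that $F_\alpha$ extends to a meromorphic function on $\mathbb C$, again denoted $F_\alpha$, and that for some $c>a$ and some sequence of radii $R_n\to\infty$ the following growth conditions hold: there is a constant $K$ with $|s|\,|F_\alpha(s)|\le K$ for all $s$ on the line $\operatorname{Re}(s)=c$, and $$\sup\{|F_\alpha(s)| : |s|=R_n,\ \operatorname{Re}(s)\le c\}\to 0\qquad (n\to\infty).$$ Then every disc $|z|<\rho$ contains only finitely many poles of $F_\alpha$, and for every $t>0$ at which $f(t)=\tfrac12\bigl(f(t^-)+f(t^+)\bigr)$ (in particular at every $t>0$ at which $f$ is continuous), $$f(t)=\sum_{k}\operatorname{Res}\bigl(e^{s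 t^\alpha/\alpha}F_\alpha(s),\ s=z_k\bigr):=\lim_{n\to\infty}\ \sum_{|z_k|<R_n}\operatorname{Res}\bigl(e^{s t^\alpha/\alpha}F_\alpha(s),\ s=z_k\bigr),$$ where $z_k$ runs over the poles of $F_\alpha$ in $\mathbb C$. If the family of residues is summable (for instance, if there are only finitely many poles), then $f(t)$ is also its unordered sum. (2) Example. Let $b\in\mathbb R$ and suppose that $F_\alpha(s)=\frac1{s-b}$ for $\operatorname{Re}(s)>a$. Then for every $t>0$ $$\operatorname{Res}\Bigl(\frac{e^{s t^\alpha/\alpha}}{s-b},\ s=b\Bigr)=e^{b t^\alpha/\alpha},$$ and $f(t)=e^{b t^\alpha/\alpha}$ at every $t>0$ at which $f(t)=\tfrac12\bigl(f(t^-)+f(t^+)\bigr)$. -/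

import Mathlib

open Filter Topology Set

/-- The conformable fractional Laplace transform based at `0`,
`F_α(s) = ∫₀^∞ exp (-s t^α / α) f(t) t^(α-1) dt`. -/
noncomputable def conformableLaplace (α : ℝ) (f : ℝ → ℝ) (s : ℂ) : ℂ :=
  ∫ t in Ioi (0 : ℝ),
    Complex.exp (-s * ((t ^ α / α : ℝ) : ℂ)) * (f t : ℂ) * ((t ^ (α - 1) : ℝ) : ℂ)

/-- Piecewise continuity on `[0, ∞)`: finitely many discontinuities in each bounded interval,
with finite one-sided limits everywhere. Values of `f` at negative arguments play no role. -/
def PiecewiseContinuousNonneg (f : ℝ → ℝ) : Prop :=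
  (∀ T : ℝ, {t ∈ Icc (0 : ℝ) T | ¬ ContinuousWithinAt f (Ici 0) t}.Finite) ∧
  (∀ t : ℝ, 0 ≤ t → ∃ r : ℝ, Tendsto f (𝓝[>] t) (𝓝 r)) ∧
  (∀ t : ℝ, 0 < t → ∃ l : ℝ, Tendsto f (𝓝[<] t) (𝓝 l))

/-- Conformable exponential order `a`: `|f(t)| ≤ M exp (a t^α / α)` on `[0, ∞)`. -/
def ConformableExpOrder (α a : ℝ) (f : ℝ → ℝ) : Prop :=
  ∃ M : ℝ, ∀ t : ℝ, 0 ≤ t → |f t| ≤ M * Real.exp (a * (t ^ α / α))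

/-- `f(t)` is the mean of the two one-sided limits of `f` at `t`. This holds at every point of
continuity; at a jump it is the usual normalization. -/
def IsNormalizedAt (f : ℝ → ℝ) (t : ℝ) : Prop :=
  ∃ l r : ℝ, Tendsto f (𝓝[<] t) (𝓝 l) ∧ Tendsto f (𝓝[>] t) (𝓝 r) ∧ f t = (l + r) / 2

theorem ContinuousAt.isNormalizedAt {f : ℝ → ℝ} {t : ℝ} (h : ContinuousAt f t) :
    IsNormalizedAt f t :=
  ⟨f t, f t, h.tendsto.mono_left nhdsWithin_le_nhds, h.tendsto.mono_left nhdsWithin_le_nhds,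
    by ring⟩

/-- The set of poles of a meromorphic function on `ℂ`. -/
def poleSet (G : ℂ → ℂ) : Set ℂ := {z | meromorphicOrderAt G z < 0}

/-- The residue at `z` of a function with an isolated singularity there: the limit (eventually
constant value) of `(2πi)⁻¹ ∮ g` over the circles of radius `ρ → 0+` about `z`. -/
noncomputable def residueAt (g : ℂ → ℂ) (z : ℂ) : ℂ :=
  limUnder (𝓝[>] (0 : ℝ))
    (fun ρ : ℝ => (2 * (Real.pi : ℂ) * Complex.I)⁻¹ * ∮ s in C(z, ρ), g s)

/-- The growth conditions for closing the line `Re s = c` to the left along the circular arcs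
`|s| = R n`, `Re s ≤ c`: `G(s) = O(1/|s|)` on the line, the radii `R n` tend to infinity, and
`G → 0` uniformly on the arcs. -/
def ContourGrowth (G : ℂ → ℂ) (c : ℝ) (R : ℕ → ℝ) : Prop :=
  (∃ M : ℝ, ∀ s : ℂ, s.re = c → ‖s‖ * ‖G s‖ ≤ M) ∧
  Tendsto R atTop atTop ∧
  (∀ ε : ℝ, 0 < ε → ∀ᶠ n in atTop, ∀ s : ℂ, ‖s‖ = R n → s.re ≤ c → ‖G s‖ ≤ ε)

/-! In the variable `u = t ^ α / α` the conformable transform becomes the ordinary Laplace transform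
of `f ((α * u) ^ (1 / α))`. On the line `Re s = c` it is therefore the Fourier transform of the
damped function `dampedOriginal`, which is bounded and integrable because `a < c`.

Piecewise continuity alone does not give pointwise Fourier inversion; the bound `|s| |F(s)| ≤ K` on
the line supplies what is missing. A smooth cutoff of the inversion integral is an average of the
function against an even kernel of mass one, so it tends to the mean of the one-sided limits.
Passing from the smooth to the sharp cutoff costs only the integral of `C / |η|` over a thin
transition zone, which is arbitrarily small (`norm_integral_cutoff_sub_le`). The result is the
Bromwich formula `tendsto_bromwich`.

The residue theorem on `|s| = R n` then converts Bromwich integrals to residue sums. The right arc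
is replaced by its chord, since the integrand is holomorphic for `Re s > a`; the left arc is
negligible by Jordan's lemma (`norm_integral_leftArc_le`). No pole lies on the circle: for `Re s >
a` the function is analytic, and on the open left arc it is bounded. If the residues are summable,
the discs exhaust the poles, so the limit is the unordered sum. -/

/-! ### Principal parts and the residue theorem on a disc. -/

/-- A meromorphic germ of the form `(s - z)⁻ⁿ k(s)` splits into a principal part, analytic off `z`
with explicitly known circle integrals, and an analytic germ. -/
theorem exists_principalPart_of_analyticAt (z : ℂ) (n : ℕ) :
    ∀ k : ℂ → ℂ, AnalyticAt ℂ k z →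
    ∃ (P k' : ℂ → ℂ) (r : ℂ), (∀ s, s ≠ z → AnalyticAt ℂ P s) ∧ MeromorphicAt P z ∧
      AnalyticAt ℂ k' z ∧
      (∀ᶠ s in 𝓝[≠] z, ((s - z) ^ n)⁻¹ * k s = P s + k' s) ∧
      (∀ w ρ, z ∈ Metric.ball w ρ → (∮ s in C(w, ρ), P s) = 2 * Real.pi * Complex.I * r) := by
  induction n with
  | zero =>
    intro k hk
    refine ⟨0, k, 0, fun s _ => analyticAt_const, analyticAt_const.meromorphicAt, hk, ?_, ?_⟩
    · simp
    · intro w ρ _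
      simp [circleIntegral]
  | succ n ih =>
    intro k hk
    obtain ⟨p, hp⟩ := hk
    -- Splitting `k s = k z + (s - z) * dslope k z s` lowers the order of the pole by one.
    have hk1 : AnalyticAt ℂ (dslope k z) z := ⟨p.fslope, hp.has_fpower_series_dslope_fslope⟩
    obtain ⟨P, k', r, hP, hPm, hk', heq, hint⟩ := ih _ hk1
    have hQ : ∀ s, s ≠ z → AnalyticAt ℂ (fun s => ((s - z) ^ (n + 1))⁻¹ * k z) s := by
      intro s hs
      refine AnalyticAt.mul (AnalyticAt.inv (by fun_prop) ?_) analyticAt_const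
      exact pow_ne_zero _ (sub_ne_zero.2 hs)
    -- Only the exponent `-1`, that is `n = 0`, contributes to the residue; higher negative powers
    -- integrate to zero around a circle.
    refine ⟨fun s => P s + ((s - z) ^ (n + 1))⁻¹ * k z, k', if n = 0 then r + k z else r,
      fun s hs => (hP s hs).add (hQ s hs), ?_, hk', ?_, ?_⟩
    · refine hPm.add ?_
      have : MeromorphicAt (fun s : ℂ => s - z) z := by fun_prop
      exact (this.pow (n + 1)).inv.mul (MeromorphicAt.const (k z) z)
    · filter_upwards [heq, self_mem_nhdsWithin] with s hs hne
      have hne' : s - z ≠ 0 := sub_ne_zero.2 hne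
      have hd : k s = k z + (s - z) * dslope k z s := by
        have := sub_smul_dslope k z s
        simp only [smul_eq_mul] at this
        rw [this]; ring
      rw [add_right_comm, ← hs, hd, pow_succ]
      field_simp
      ring
    · intro w ρ hz
      have hρ : 0 < ρ := Metric.pos_of_mem_ball hz
      have hne : ∀ s ∈ Metric.sphere w ρ, s ≠ z := by
        rintro s hs rfl
        rw [Metric.mem_sphere] at hs
        rw [Metric.mem_ball] at hz
        exact absurd hs hz.ne
      rw [circleIntegral.integral_add, hint w ρ hz]
      · simp_rw [mul_comm _ (k z)]
        rw [circleIntegral.integral_const_mul]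
        split_ifs with h0
        · subst h0
          have := circleIntegral.integral_sub_inv_of_mem_ball hz
          simp only [zero_add, pow_one]
          rw [this]; ring
        · have := circleIntegral.integral_sub_zpow_of_ne (n := -((n : ℤ) + 1)) (by omega) w z ρ
          simp only [zpow_neg] at this
          norm_cast at this
          rw [this]; ring
      · exact ContinuousOn.circleIntegrable hρ.le fun s hs =>
          (hP s (hne s hs)).continuousAt.continuousWithinAt
      · exact ContinuousOn.circleIntegrable hρ.le fun s hs =>
          (hQ s (hne s hs)).continuousAt.continuousWithinAt

theorem MeromorphicAt.exists_principalPart {g : ℂ → ℂ} {z : ℂ} (hg : MeromorphicAt g z) :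
    ∃ (P k : ℂ → ℂ) (r : ℂ), (∀ s, s ≠ z → AnalyticAt ℂ P s) ∧ MeromorphicAt P z ∧
      AnalyticAt ℂ k z ∧ (∀ᶠ s in 𝓝[≠] z, g s = P s + k s) ∧
      (∀ w ρ, z ∈ Metric.ball w ρ → (∮ s in C(w, ρ), P s) = 2 * Real.pi * Complex.I * r) := by
  obtain ⟨n, hn⟩ := hg
  obtain ⟨P, k, r, h1, h2, h3, h4, h5⟩ := exists_principalPart_of_analyticAt z n _ hn
  refine ⟨P, k, r, h1, h2, h3, ?_, h5⟩
  filter_upwards [h4, self_mem_nhdsWithin] with s hs hne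
  have hne' : s - z ≠ 0 := sub_ne_zero.2 hne
  rw [← hs, smul_eq_mul, ← mul_assoc, inv_mul_cancel₀ (pow_ne_zero _ hne'), one_mul]

/-- A function whose small circle integrals about `z` are `2πi r` has residue `r`. -/
theorem residueAt_eq_of_eventually {g : ℂ → ℂ} {z r : ℂ}
    (h : ∀ᶠ ρ in 𝓝[>] (0 : ℝ), (∮ s in C(z, ρ), g s) = 2 * Real.pi * Complex.I * r) :
    residueAt g z = r := by
  refine Tendsto.limUnder_eq (tendsto_const_nhds.congr' ?_)
  filter_upwards [h] with ρ hρ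
  rw [hρ, inv_mul_cancel_left₀ Complex.two_pi_I_ne_zero]

/-- A property of the punctured germ at `z` holds on all small punctured discs about `z`. -/
theorem eventually_nhdsGT_of_nhdsNE {z : ℂ} {p : ℂ → Prop} (h : ∀ᶠ s in 𝓝[≠] z, p s) :
    ∀ᶠ ρ in 𝓝[>] (0 : ℝ), ∀ s ∈ Metric.closedBall z ρ, s ≠ z → p s := by
  rw [eventually_nhdsWithin_iff, Metric.eventually_nhds_iff] at h
  obtain ⟨ε, hε, h⟩ := h
  filter_upwards [Ioo_mem_nhdsGT hε] with ρ hρ s hs hne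
  exact h (lt_of_le_of_lt (Metric.mem_closedBall.1 hs) hρ.2) hne

theorem residueAt_eq_of_principalPart {g P k : ℂ → ℂ} {z r : ℂ}
    (hP : ∀ s, s ≠ z → AnalyticAt ℂ P s) (hk : AnalyticAt ℂ k z)
    (hg : ∀ᶠ s in 𝓝[≠] z, g s = P s + k s)
    (hint : ∀ w ρ, z ∈ Metric.ball w ρ → (∮ s in C(w, ρ), P s) = 2 * Real.pi * Complex.I * r) :
    residueAt g z = r := by
  apply residueAt_eq_of_eventually
  have hk' := eventually_nhdsGT_of_nhdsNE (hk.eventually_analyticAt.filter_mono nhdsWithin_le_nhds)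
  filter_upwards [eventually_nhdsGT_of_nhdsNE hg, hk', self_mem_nhdsWithin] with ρ h1 h2 hρ
  rw [mem_Ioi] at hρ
  have h2' : ∀ s ∈ Metric.closedBall z ρ, AnalyticAt ℂ k s := by
    intro s hs
    by_cases h : s = z
    · rwa [h]
    · exact h2 s hs h
  have hne : ∀ s ∈ Metric.sphere z ρ, s ≠ z := by
    rintro s hs rfl
    simp at hs
    exact hρ.ne hs
  rw [circleIntegral.integral_congr hρ.le
    (fun s hs => h1 s (Metric.sphere_subset_closedBall hs) (hne s hs)),
    circleIntegral.integral_add, hint z ρ (Metric.mem_ball_self hρ)]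
  · rw [Complex.circleIntegral_eq_zero_of_differentiable_on_off_countable hρ.le countable_empty
      (fun s hs => (h2' s hs).continuousAt.continuousWithinAt)
      (fun s hs => (h2' s (Metric.ball_subset_closedBall hs.1)).differentiableAt), add_zero]
  · exact ContinuousOn.circleIntegrable hρ.le fun s hs =>
      (hP s (hne s hs)).continuousAt.continuousWithinAt
  · exact ContinuousOn.circleIntegrable hρ.le fun s hs =>
      (h2' s (Metric.sphere_subset_closedBall hs)).continuousAt.continuousWithinAt

/-- Nonnegative order still allows arbitrary values at removable singularities. The normal form
repairs these and is analytic on the disc, so Cauchy's theorem applies to it; the change is on a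
codiscrete set, which circle integrals do not see. -/
theorem Meromorphic.circleIntegrable_and_integral_eq_zero {h : ℂ → ℂ} (hm : Meromorphic h) {w : ℂ}
    {R : ℝ} (hR : 0 < R) (hord : ∀ z ∈ Metric.closedBall w R, 0 ≤ meromorphicOrderAt h z) :
    CircleIntegrable h w R ∧ (∮ s in C(w, R), h s) = 0 := by
  have hm' : MeromorphicOn h univ := fun z _ => hm z
  set H := toMeromorphicNFOn h univ with hH
  have hHa : ∀ z ∈ Metric.closedBall w R, AnalyticAt ℂ H z := fun z hz => by
    rw [← (meromorphicNFOn_toMeromorphicNFOn h univ (mem_univ z)).meromorphicOrderAt_nonneg_iff_analyticAt,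
      meromorphicOrderAt_toMeromorphicNFOn hm' (mem_univ z)]
    exact hord z hz
  have heq : H =ᶠ[codiscreteWithin (Metric.sphere w |R|)] h :=
    ((toMeromorphicNFOn_eqOn_codiscrete hm').symm).filter_mono
      (codiscreteWithin_mono (subset_univ _))
  constructor
  · refine CircleIntegrable.congr_codiscreteWithin heq ?_
    exact ContinuousOn.circleIntegrable hR.le fun s hs =>
      (hHa s (Metric.sphere_subset_closedBall hs)).continuousAt.continuousWithinAt
  · rw [← circleIntegral.circleIntegral_congr_codiscreteWithin heq hR.ne']
    exact Complex.circleIntegral_eq_zero_of_differentiable_on_off_countable hR.le countable_empty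
      (fun s hs => (hHa s hs).continuousAt.continuousWithinAt)
      (fun s hs => (hHa s (Metric.ball_subset_closedBall hs.1)).differentiableAt)

/-- The residue theorem on a disc. -/
theorem Meromorphic.circleIntegral_eq_sum_residueAt {g : ℂ → ℂ} (hg : Meromorphic g) {w : ℂ} {R : ℝ}
    (hR : 0 < R) (S : Finset ℂ) (hS : ∀ z ∈ S, z ∈ Metric.ball w R)
    (hord : ∀ z ∈ Metric.closedBall w R, z ∉ S → 0 ≤ meromorphicOrderAt g z) :
    CircleIntegrable g w R ∧
      (∮ s in C(w, R), g s) = 2 * Real.pi * Complex.I * ∑ z ∈ S, residueAt g z := by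
  choose P k r hP hPm hk heq hint using fun z => (hg z).exists_principalPart
  have hPm' : ∀ z, Meromorphic (P z) := fun z s => by
    by_cases h : s = z
    · rw [h]; exact hPm z
    · exact (hP z s h).meromorphicAt
  -- Near a point of `S` every principal part but its own is analytic, so `g - Q` has nonnegative
  -- order on the whole closed disc and integrates to zero.
  set Q : ℂ → ℂ := fun s => ∑ z ∈ S, P z s with hQ
  have hQm : Meromorphic Q := fun s => MeromorphicAt.fun_sum fun z _ => hPm' z s
  have hPc : ∀ z ∈ S, CircleIntegrable (P z) w R := fun z hz =>
    ContinuousOn.circleIntegrable hR.le fun s hs => by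
      refine (hP z s ?_).continuousAt.continuousWithinAt
      rintro rfl
      exact absurd (Metric.mem_sphere.1 hs) (Metric.mem_ball.1 (hS s hz)).ne
  have hQc : CircleIntegrable Q w R := CircleIntegrable.fun_sum S hPc
  have hhm : Meromorphic (fun s => g s - Q s) := fun s => (hg s).sub (hQm s)
  have key := hhm.circleIntegrable_and_integral_eq_zero hR (w := w) (fun z hz => by
    by_cases hzS : z ∈ S
    · have hsum : AnalyticAt ℂ (fun s => k z s - ∑ z' ∈ S.erase z, P z' s) z := by
        refine (hk z).sub (Finset.analyticAt_fun_sum _ fun z' hz' => hP z' z ?_)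
        exact (Finset.ne_of_mem_erase hz').symm
      rw [meromorphicOrderAt_congr (f₂ := fun s => k z s - ∑ z' ∈ S.erase z, P z' s)]
      · exact hsum.meromorphicOrderAt_nonneg
      · filter_upwards [heq z] with s hs
        rw [hs, hQ]
        simp only
        rw [← Finset.add_sum_erase S _ hzS]
        ring
    · have hQa : AnalyticAt ℂ Q z := Finset.analyticAt_fun_sum _ fun z' hz' => hP z' z
        (by rintro rfl; exact hzS hz')
      have h1 := hord z hz hzS
      refine le_trans (le_min h1 hQa.neg.meromorphicOrderAt_nonneg) ?_
      have := meromorphicOrderAt_add (hg z) hQa.neg.meromorphicAt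
      simpa [sub_eq_add_neg] using! this)
  have hgQ : g = fun s => (g s - Q s) + Q s := by ext s; ring
  constructor
  · rw [hgQ]; exact key.1.add hQc
  · conv_lhs => rw [hgQ]
    rw [circleIntegral.integral_add key.1 hQc, key.2, zero_add, circleIntegral.integral_fun_sum hPc,
      Finset.mul_sum]
    refine Finset.sum_congr rfl fun z hz => ?_
    rw [hint z w R (hS z hz), residueAt_eq_of_principalPart (hP z) (hk z) (heq z) (hint z)]

/-- The poles of a meromorphic function on `ℂ` in a bounded disc are finite in number. -/
theorem Meromorphic.finite_poleSet_inter_ball {G : ℂ → ℂ} (hG : Meromorphic G) (ρ : ℝ) :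
    (poleSet G ∩ Metric.ball 0 ρ).Finite := by
  refine Set.Finite.subset (s := poleSet G ∩ Metric.closedBall 0 ρ) ?_
    (inter_subset_inter_right _ Metric.ball_subset_closedBall)
  by_contra hinf
  obtain ⟨x, -, hx⟩ := Set.Infinite.exists_accPt_of_subset_isCompact hinf
    (isCompact_closedBall (0 : ℂ) ρ) inter_subset_right
  rw [accPt_iff_frequently_nhdsNE] at hx
  refine hx ?_
  filter_upwards [(hG x).eventually_analyticAt] with s hs hmem
  exact absurd hmem.1 (not_lt.2 hs.meromorphicOrderAt_nonneg)

/-! ### Jordan's lemma on the left arc. -/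

theorem integral_exp_neg_mul_abs_sub {b : ℝ} (hb : 0 < b) (x₀ : ℝ) :
    ∫ x : ℝ, Real.exp (-b * |x - x₀|) = 2 / b := by
  rw [MeasureTheory.integral_sub_right_eq_self (fun x => Real.exp (-b * |x|)) x₀,
    integral_comp_abs (f := fun x => Real.exp (-b * x)), integral_exp_mul_Ioi (by linarith)]
  simp
  field_simp

theorem integrable_exp_neg_mul_abs_sub {b : ℝ} (hb : 0 < b) (x₀ : ℝ) :
    MeasureTheory.Integrable fun x : ℝ => Real.exp (-b * |x - x₀|) := by
  -- A non-integrable function has integral `0` by convention, so the nonzero value already computed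
  -- forces integrability.
  refine MeasureTheory.Integrable.of_integral_ne_zero ?_
  rw [integral_exp_neg_mul_abs_sub hb]
  positivity

/-- For `x ≥ 0` this is Jordan's inequality `sin x ≥ 2x/π`. For `x ≤ 0`, where the arc lies to the
right of the imaginary axis, the constraint by `c` bounds both the exponent and the decay term by
`τ|c|`; hence the factor `exp (2τ|c|)`. -/
theorem exp_neg_mul_sin_le {τ R c x : ℝ} (hτ : 0 < τ) (hR : 0 < R) (hx : |x| ≤ Real.pi / 2)
    (hc : -(R * Real.sin x) ≤ c) :
    Real.exp (-(τ * (R * Real.sin x))) ≤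
      Real.exp (2 * τ * |c|) * Real.exp (-(2 * τ / Real.pi * R) * |x|) := by
  rw [← Real.exp_add, Real.exp_le_exp]
  have hcc := le_abs_self c
  rcases le_total 0 x with h | h
  · rw [abs_of_nonneg h] at *
    have h1 := Real.mul_le_sin h hx
    have h2 : τ * (R * (2 / Real.pi * x)) ≤ τ * (R * Real.sin x) := by gcongr
    have h3 : τ * (R * (2 / Real.pi * x)) = (2 * τ / Real.pi * R) * x := by ring
    have h4 : 0 ≤ 2 * τ * |c| := by positivity
    linarith
  · rw [abs_of_nonpos h] at *
    have h1 := Real.mul_le_sin (neg_nonneg.2 h) hx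
    rw [Real.sin_neg] at h1
    have h2 : τ * (R * (2 / Real.pi * (-x))) ≤ τ * |c| := by
      gcongr
      calc R * (2 / Real.pi * (-x)) ≤ R * (-Real.sin x) := by gcongr
        _ ≤ |c| := by linarith
    have h3 : τ * (R * (2 / Real.pi * (-x))) = (2 * τ / Real.pi * R) * (-x) := by ring
    have h5 : τ * (-(R * Real.sin x)) ≤ τ * |c| := by gcongr; linarith
    linarith

/-- Jordan's estimate on the arc `|s| = R`, `Re s ≤ c`, parametrised by `θ`. -/
theorem exp_mul_cos_le {τ R c θ : ℝ} (hτ : 0 < τ) (hR : 0 < R) (h0 : 0 ≤ θ) (h2 : θ ≤ 2 * Real.pi)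
    (hc : R * Real.cos θ ≤ c) :
    Real.exp (τ * (R * Real.cos θ)) ≤ Real.exp (2 * τ * |c|) *
      (Real.exp (-(2 * τ / Real.pi * R) * |θ - Real.pi / 2|) +
        Real.exp (-(2 * τ / Real.pi * R) * |θ - 3 * Real.pi / 2|)) := by
  rcases le_total θ Real.pi with h | h
  · have hs : Real.sin (θ - Real.pi / 2) = -Real.cos θ := Real.sin_sub_pi_div_two θ
    have key := exp_neg_mul_sin_le (x := θ - Real.pi / 2) (c := c) hτ hR
      (abs_le.2 ⟨by linarith, by linarith⟩) (by rw [hs]; linarith)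
    rw [hs] at key
    have e : -(τ * (R * -Real.cos θ)) = τ * (R * Real.cos θ) := by ring
    rw [e] at key
    refine key.trans ?_
    gcongr
    exact le_add_of_nonneg_right (Real.exp_nonneg _)
  · have hs : Real.sin (3 * Real.pi / 2 - θ) = -Real.cos θ := by
      have : 3 * Real.pi / 2 - θ = Real.pi / 2 - (θ - Real.pi) := by ring
      rw [this, Real.sin_pi_div_two_sub, Real.cos_sub_pi]
    have key := exp_neg_mul_sin_le (x := 3 * Real.pi / 2 - θ) (c := c) hτ hR
      (abs_le.2 ⟨by linarith, by linarith⟩) (by rw [hs]; linarith)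
    rw [hs] at key
    have e : -(τ * (R * -Real.cos θ)) = τ * (R * Real.cos θ) := by ring
    rw [e, abs_sub_comm] at key
    refine key.trans ?_
    gcongr
    exact le_add_of_nonneg_left (Real.exp_nonneg _)

/-- Jordan's lemma for the arc `|s| = R`, `Re s ≤ c`. -/
theorem norm_integral_leftArc_le {τ R c ε : ℝ} {G : ℂ → ℂ} (hτ : 0 < τ) (hR : 0 < R)
    (hcR : |c| ≤ R) (hG : ∀ s : ℂ, ‖s‖ = R → s.re ≤ c → ‖G s‖ ≤ ε) :
    ‖∫ θ in Real.arccos (c / R)..(2 * Real.pi - Real.arccos (c / R)),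
      deriv (circleMap 0 R) θ • (Complex.exp (circleMap 0 R θ * τ) * G (circleMap 0 R θ))‖ ≤
      ε * (Real.exp (2 * τ * |c|) * (2 * Real.pi / τ)) := by
  set θ₀ := Real.arccos (c / R) with hθ₀
  have hc1 : -1 ≤ c / R := by rw [le_div_iff₀ hR]; linarith [(abs_le.1 hcR).1]
  have hc2 : c / R ≤ 1 := by rw [div_le_iff₀ hR]; linarith [(abs_le.1 hcR).2]
  have hcos : Real.cos θ₀ = c / R := Real.cos_arccos hc1 hc2
  have h0 : 0 ≤ θ₀ := Real.arccos_nonneg _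
  have hπ : θ₀ ≤ Real.pi := Real.arccos_le_pi _
  set κ := 2 * τ / Real.pi * R with hκ
  have hκ0 : 0 < κ := by positivity
  -- The two exponentials have total mass `4/κ = 2π/(τR)`, which cancels the factor `R` from the arc
  -- length.
  set B : ℝ → ℝ := fun θ => R * ε * Real.exp (2 * τ * |c|) *
    (Real.exp (-κ * |θ - Real.pi / 2|) + Real.exp (-κ * |θ - 3 * Real.pi / 2|)) with hB
  have hBint : MeasureTheory.Integrable B :=
    ((integrable_exp_neg_mul_abs_sub hκ0 _).add (integrable_exp_neg_mul_abs_sub hκ0 _)).const_mul _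
  have hε : 0 ≤ ε := by
    refine (norm_nonneg _).trans (hG (-R) ?_ ?_)
    · simp [abs_of_pos hR]
    · simp; linarith [(abs_le.1 hcR).1]
  have hle : θ₀ ≤ 2 * Real.pi - θ₀ := by linarith
  have hbound : ∀ θ ∈ Icc θ₀ (2 * Real.pi - θ₀),
      ‖deriv (circleMap 0 R) θ • (Complex.exp (circleMap 0 R θ * τ) * G (circleMap 0 R θ))‖ ≤
        B θ := by
    rintro θ ⟨h1, h2⟩
    have hcosle : R * Real.cos θ ≤ c := by
      have : Real.cos θ ≤ Real.cos θ₀ := by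
        rcases le_total θ Real.pi with h | h
        · exact Real.cos_le_cos_of_nonneg_of_le_pi h0 h h1
        · rw [← Real.cos_two_pi_sub θ]
          exact Real.cos_le_cos_of_nonneg_of_le_pi h0 (by linarith) (by linarith)
      rw [hcos, le_div_iff₀ hR] at this
      linarith
    have hGθ := hG (circleMap 0 R θ) (by simp [abs_of_pos hR]) (by rwa [circleMap_zero_re])
    have hexp := exp_mul_cos_le hτ hR (h0.trans h1) (by linarith) hcosle
    rw [← hκ] at hexp
    have hre : (circleMap 0 R θ * τ).re = τ * (R * Real.cos θ) := by
      rw [Complex.re_mul_ofReal, circleMap_zero_re]; ring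
    rw [norm_smul, norm_mul, Complex.norm_exp, hre]
    have hd : ‖deriv (circleMap 0 R) θ‖ = R := by simp [abs_of_pos hR]
    rw [hd]
    calc R * (Real.exp (τ * (R * Real.cos θ)) * ‖G (circleMap 0 R θ)‖)
        ≤ R * ((Real.exp (2 * τ * |c|) * (Real.exp (-κ * |θ - Real.pi / 2|) +
          Real.exp (-κ * |θ - 3 * Real.pi / 2|))) * ε) := by gcongr
      _ = B θ := by simp only [hB]; ring
  calc _ ≤ ∫ θ in θ₀..(2 * Real.pi - θ₀), B θ :=
        intervalIntegral.norm_integral_le_of_norm_le hle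
          (MeasureTheory.ae_of_all _ fun θ hθ => hbound θ (Ioc_subset_Icc_self hθ))
          hBint.intervalIntegrable
    _ ≤ ∫ θ, B θ := by
        rw [intervalIntegral.integral_of_le hle]
        refine MeasureTheory.setIntegral_le_integral hBint (MeasureTheory.ae_of_all _ fun θ => ?_)
        simp only [hB, Pi.zero_apply]; positivity
    _ = ε * (Real.exp (2 * τ * |c|) * (2 * Real.pi / τ)) := by
        simp only [hB]
        rw [MeasureTheory.integral_const_mul, MeasureTheory.integral_add
          (integrable_exp_neg_mul_abs_sub hκ0 _) (integrable_exp_neg_mul_abs_sub hκ0 _),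
          integral_exp_neg_mul_abs_sub hκ0, integral_exp_neg_mul_abs_sub hκ0, hκ]
        field_simp
        ring

/-! ### Splitting the circle into a chord and the left arc. -/

/-- Bounded pieces of a half-plane `c ≤ Re s` lie in a disc inside `a < Re s`. -/
theorem exists_ball_halfPlane {a c : ℝ} (hac : a < c) (R : ℝ) :
    ∃ (w : ℂ) (L : ℝ), (∀ s ∈ Metric.ball w L, a < s.re) ∧
      ∀ s : ℂ, ‖s‖ ≤ R → c ≤ s.re → s ∈ Metric.ball w L := by
  -- The disc is tangent to `Re s = a` at `a`. A point `s` lies in it when `|s - a|² < 2L (Re s -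
  -- a)`, which follows from `(R + |a|)² < (c - a) L`; the `+ 1` makes this strict.
  set L := (R + |a|) ^ 2 / (c - a) + 1 with hL
  have hca : 0 < c - a := sub_pos.2 hac
  have hLpos : 0 < L := by positivity
  refine ⟨((a + L : ℝ) : ℂ), L, fun s hs => ?_, fun s hs hre => ?_⟩
  · rw [Metric.mem_ball, Complex.dist_eq] at hs
    have h2 := lt_of_le_of_lt (Complex.abs_re_le_norm (s - ((a + L : ℝ) : ℂ))) hs
    have h3 := (abs_lt.1 h2).1
    simp only [Complex.sub_re, Complex.ofReal_re] at h3
    linarith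
  · rw [Metric.mem_ball, Complex.dist_eq]
    refine lt_of_pow_lt_pow_left₀ 2 hLpos.le ?_
    have h1 : ‖s - a‖ ≤ R + |a| := (norm_sub_le _ _).trans (by simpa using hs)
    have h2 : ‖s - a‖ ^ 2 ≤ (R + |a|) ^ 2 := by gcongr
    rw [← Complex.normSq_eq_norm_sq, Complex.normSq_apply] at h2 ⊢
    simp only [Complex.sub_re, Complex.sub_im, Complex.ofReal_re, Complex.ofReal_im] at h2 ⊢
    have h3 : (R + |a|) ^ 2 < (c - a) * L := by
      rw [hL, mul_add, mul_div_cancel₀ _ hca.ne']; linarith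
    have h4 : (c - a) * L ≤ (s.re - a) * L := by gcongr
    nlinarith

/-- In a half-plane of holomorphy, the arc `|s| = R`, `Re s ≥ c` may be replaced by its chord. -/
theorem integral_rightArc_eq_chord {g : ℂ → ℂ} {a c R : ℝ} (hac : a < c) (hR : 0 < R)
    (hcR : |c| ≤ R) (hg : ∀ s : ℂ, a < s.re → DifferentiableAt ℂ g s) :
    (∫ θ in (-Real.arccos (c / R))..(Real.arccos (c / R)),
      deriv (circleMap 0 R) θ • g (circleMap 0 R θ)) =
    ∫ y in (-√(R ^ 2 - c ^ 2))..(√(R ^ 2 - c ^ 2)), Complex.I * g (c + y * Complex.I) := by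
  obtain ⟨w, L, hball, hmem⟩ := exists_ball_halfPlane hac R
  -- Arc and chord lie in one disc of holomorphy and share their endpoints, so a primitive there
  -- gives both integrals the same value.
  obtain ⟨Φ, hΦ⟩ := DifferentiableOn.isExactOn_ball (f := g) (c := w) (r := L)
    fun s hs => (hg s (hball s hs)).differentiableWithinAt
  set θ₀ := Real.arccos (c / R) with hθ₀
  set Y := √(R ^ 2 - c ^ 2) with hY
  have hcsq : c ^ 2 ≤ R ^ 2 := sq_le_sq' (by linarith [(abs_le.1 hcR).1]) (abs_le.1 hcR).2
  have hYsq : Y ^ 2 = R ^ 2 - c ^ 2 := Real.sq_sqrt (by linarith)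
  have hY0 : 0 ≤ Y := Real.sqrt_nonneg _
  have hc1 : -1 ≤ c / R := by rw [le_div_iff₀ hR]; linarith [(abs_le.1 hcR).1]
  have hc2 : c / R ≤ 1 := by rw [div_le_iff₀ hR]; linarith [(abs_le.1 hcR).2]
  have hcos : R * Real.cos θ₀ = c := by
    rw [Real.cos_arccos hc1 hc2]; field_simp
  have hsin : R * Real.sin θ₀ = Y := by
    have h1 : 0 ≤ R * Real.sin θ₀ :=
      mul_nonneg hR.le (Real.sin_nonneg_of_nonneg_of_le_pi (Real.arccos_nonneg _)
        (Real.arccos_le_pi _))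
    have h2 : (R * Real.sin θ₀) ^ 2 = Y ^ 2 := by
      rw [hYsq, ← hcos, mul_pow, mul_pow, Real.sin_sq]
      ring
    exact (pow_left_inj₀ h1 hY0 two_ne_zero).1 h2
  have h0 : 0 ≤ θ₀ := Real.arccos_nonneg _
  have hπ : θ₀ ≤ Real.pi := Real.arccos_le_pi _
  have harc : ∀ θ ∈ uIcc (-θ₀) θ₀, circleMap 0 R θ ∈ Metric.ball w L := by
    intro θ hθ
    rw [uIcc_of_le (by linarith)] at hθ
    refine hmem _ (by simp [abs_of_pos hR]) ?_
    rw [circleMap_zero_re, ← hcos]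
    gcongr
    rw [← Real.cos_abs θ]
    exact Real.cos_le_cos_of_nonneg_of_le_pi (abs_nonneg _) hπ (abs_le.2 hθ)
  have hchord : ∀ y ∈ uIcc (-Y) Y, (c + y * Complex.I : ℂ) ∈ Metric.ball w L := by
    intro y hy
    rw [uIcc_of_le (by linarith)] at hy
    refine hmem _ ?_ (by simp)
    refine le_of_sq_le_sq ?_ hR.le
    rw [← Complex.normSq_eq_norm_sq, Complex.normSq_apply]
    simp
    have := sq_le_sq' hy.1 hy.2
    nlinarith
  have hcont : ContinuousOn g (Metric.ball w L) := fun s hs =>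
    (hg s (hball s hs)).continuousAt.continuousWithinAt
  have e1 : circleMap 0 R θ₀ = c + Y * Complex.I := by
    apply Complex.ext
    · rw [circleMap_zero_re, hcos]; simp
    · rw [circleMap_zero_im, hsin]; simp
  have e2 : circleMap 0 R (-θ₀) = c + (-Y : ℝ) * Complex.I := by
    apply Complex.ext
    · rw [circleMap_zero_re, Real.cos_neg, hcos]; simp
    · rw [circleMap_zero_im, Real.sin_neg, mul_neg, hsin]; simp
  have i1 := intervalIntegral.integral_eq_sub_of_hasDerivAt
    (f := fun θ => Φ (circleMap 0 R θ))
    (f' := fun θ => deriv (circleMap 0 R) θ • g (circleMap 0 R θ)) (a := -θ₀) (b := θ₀)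
    (fun θ hθ => by
      have := (hΦ _ (harc θ hθ)).scomp θ ((differentiable_circleMap 0 R) θ).hasDerivAt
      simpa [Function.comp_def] using this)
    (by
      refine ContinuousOn.intervalIntegrable ?_
      refine ContinuousOn.smul (f := deriv (circleMap 0 R)) ?_ (hcont.comp (continuous_circleMap 0 R).continuousOn harc)
      have : deriv (circleMap 0 R) = fun θ => circleMap 0 R θ * Complex.I := by
        ext θ; simp
      rw [this]; fun_prop)
  have i2 := intervalIntegral.integral_eq_sub_of_hasDerivAt
    (f := fun y : ℝ => Φ (c + y * Complex.I))
    (f' := fun y : ℝ => Complex.I * g (c + y * Complex.I)) (a := -Y) (b := Y)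
    (fun y hy => by
      have hd : HasDerivAt (fun y : ℝ => (c + y * Complex.I : ℂ)) Complex.I y := by
        simpa using ((Complex.ofRealCLM.hasDerivAt (x := y)).mul_const Complex.I).const_add (c : ℂ)
      have := (hΦ _ (hchord y hy)).scomp y hd
      simpa [Function.comp_def] using this)
    (by
      refine ContinuousOn.intervalIntegrable ?_
      refine ContinuousOn.mul continuousOn_const (hcont.comp (by fun_prop) hchord))
  rw [i1, i2, e1, e2]

/-- A circle integral splits into the integral over the chord on `Re s = c`, where the function is
holomorphic to the right of `Re s = a < c`, and the integral over the left arc. -/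
theorem circleIntegral_eq_chord_add_leftArc {g : ℂ → ℂ} {a c R : ℝ} (hac : a < c) (hR : 0 < R)
    (hcR : |c| ≤ R) (hg : ∀ s : ℂ, a < s.re → DifferentiableAt ℂ g s)
    (hint : CircleIntegrable g 0 R) :
    (∮ s in C(0, R), g s) =
      (∫ y in (-√(R ^ 2 - c ^ 2))..(√(R ^ 2 - c ^ 2)), Complex.I * g (c + y * Complex.I)) +
      ∫ θ in (Real.arccos (c / R))..(2 * Real.pi - Real.arccos (c / R)),
        deriv (circleMap 0 R) θ • g (circleMap 0 R θ) := by
  rw [← integral_rightArc_eq_chord hac hR hcR hg]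
  have hper : Function.Periodic (fun θ => deriv (circleMap 0 R) θ • g (circleMap 0 R θ))
      (2 * Real.pi) := fun θ => by simp [periodic_circleMap 0 R θ]
  have hi : ∀ t₁ t₂, IntervalIntegrable
      (fun θ => deriv (circleMap 0 R) θ • g (circleMap 0 R θ)) MeasureTheory.volume t₁ t₂ :=
    hper.intervalIntegrable₀ Real.two_pi_pos.ne' hint.out
  rw [intervalIntegral.integral_add_adjacent_intervals (hi _ _) (hi _ _), circleIntegral]
  -- The period is started at `-arccos (c / R)` instead of `0`, so that the right arc comes first.
  have := hper.intervalIntegral_add_eq 0 (-Real.arccos (c / R))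
  rw [zero_add] at this
  rw [this]
  congr 1
  ring

/-! ### Pointwise Fourier inversion under `O(1/|ξ|)` decay. -/

section FourierInversion
open MeasureTheory FourierTransform

/-- Smooth even cutoffs equal to `1` on `[-1, 1]` and `0` off `[-lam, lam]`; their Fourier
transforms are even integrable kernels of total mass `1`. -/
theorem exists_cutoff {lam : ℝ} (hlam : 1 < lam) :
    ∃ w : ℝ → ℝ, Continuous w ∧ (∀ x, w (-x) = w x) ∧ (∀ x, |x| ≤ 1 → w x = 1) ∧
      (∀ x, lam ≤ |x| → w x = 0) ∧ (∀ x, 0 ≤ w x) ∧ (∀ x, w x ≤ 1) ∧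
      Integrable (fun x => (w x : ℂ)) ∧ Integrable (𝓕 fun x => (w x : ℂ)) ∧
      (∫ x, 𝓕 (fun x => (w x : ℂ)) x) = 1 := by
  set b : ContDiffBump (0 : ℝ) := ⟨1, lam, one_pos, hlam⟩ with hb
  have hsupp : HasCompactSupport (fun x => (b x : ℂ)) :=
    b.hasCompactSupport.comp_left (g := ((↑) : ℝ → ℂ)) Complex.ofReal_zero
  have hcd : ContDiff ℝ (⊤ : ℕ∞) (fun x => (b x : ℂ)) := Complex.ofRealCLM.contDiff.comp b.contDiff
  set W := hsupp.toSchwartzMap hcd with hW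
  have hWc : (W : ℝ → ℂ) = fun x => (b x : ℂ) := rfl
  have hone : ∀ x, |x| ≤ 1 → b x = 1 := fun x hx =>
    b.one_of_mem_closedBall (by simpa [hb] using hx)
  refine ⟨b, b.continuous, b.neg, hone, fun x hx => b.zero_of_le_dist (by simpa [hb] using hx),
    fun x => b.nonneg, fun x => b.le_one, hWc ▸ W.integrable, ?_, ?_⟩
  · have := (𝓕 W).integrable (μ := volume)
    rwa [SchwartzMap.fourier_coe] at this
  · have h1 : 𝓕⁻ (𝓕 W) = W := FourierTransform.fourierInv_fourier_eq W
    -- Fourier inversion at `0` identifies the mass of the kernel with the value of the cutoff at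
    -- `0`, which is `1`.
    have h2 : (𝓕⁻ (𝓕 W)) 0 = W 0 := by rw [h1]
    rw [SchwartzMap.fourierInv_coe, SchwartzMap.fourier_coe, hWc, Real.fourierInv_eq'] at h2
    simpa [hone 0 (by simp)] using h2

theorem fourier_even {w : ℝ → ℂ} (hw : ∀ x, w (-x) = w x) (x : ℝ) : 𝓕 w (-x) = 𝓕 w x := by
  rw [← Real.fourierInv_eq_fourier_neg, Real.fourierInv_eq_fourier_comp_neg]
  simp [hw]

theorem integral_Ioi_eq_half_of_even {k : ℝ → ℂ} (hk : Integrable k) (heven : ∀ x, k (-x) = k x) :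
    (∫ x in Ioi 0, k x) = (∫ x, k x) / 2 ∧ (∫ x in Iic 0, k x) = (∫ x, k x) / 2 := by
  have h1 : (∫ x in Ioi (0 : ℝ), k x) = ∫ x in Iic (0 : ℝ), k x := by
    have := integral_comp_neg_Ioi (0 : ℝ) k
    simpa [heven] using this
  have h2 : (∫ x in Iic (0 : ℝ), k x) + (∫ x in Ioi (0 : ℝ), k x) = ∫ x, k x := by
    rw [← setIntegral_union (Iic_disjoint_Ioi le_rfl) measurableSet_Ioi hk.integrableOn
      hk.integrableOn, Iic_union_Ioi, setIntegral_univ]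
  rw [← h2, ← h1]
  constructor <;> ring

/-- Averaging a bounded function against the dilates of an even kernel of mass `1` converges to the
mean of its one-sided limits. -/
theorem tendsto_integral_even_kernel {k h : ℝ → ℂ} {τ B : ℝ} {l r : ℂ} (hk : Integrable k)
    (heven : ∀ x, k (-x) = k x) (hmass : (∫ x, k x) = 1) (hh : Integrable h)
    (hB : ∀ u, ‖h u‖ ≤ B) (hl : Tendsto h (𝓝[<] τ) (𝓝 l)) (hr : Tendsto h (𝓝[>] τ) (𝓝 r)) :
    Tendsto (fun Y : ℝ => ∫ x, k x * h (τ - x / Y)) atTop (𝓝 ((l + r) / 2)) := by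
  -- The pointwise limit of the integrand: for `x > 0` the point `τ - x / Y` approaches `τ` from the
  -- left, which selects `l`. Evenness gives each half-line mass `1/2`.
  set m : ℝ → ℂ := fun x => k x * (if 0 < x then l else r) with hm
  have hmint : (∫ x, m x) = (l + r) / 2 := by
    obtain ⟨h1, h2⟩ := integral_Ioi_eq_half_of_even hk heven
    have e1 : ∀ x ∈ Ioi (0 : ℝ), m x = k x * l := fun x hx => by
      simp [hm, mem_Ioi.1 hx]
    have e2 : ∀ x ∈ Iic (0 : ℝ), m x = k x * r := fun x hx => by
      simp [hm, not_lt.2 (mem_Iic.1 hx)]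
    have i1 : IntegrableOn m (Ioi 0) :=
      IntegrableOn.congr_fun (hk.integrableOn.mul_const l) (fun x hx => (e1 x hx).symm)
        measurableSet_Ioi
    have i2 : IntegrableOn m (Iic 0) :=
      IntegrableOn.congr_fun (hk.integrableOn.mul_const r) (fun x hx => (e2 x hx).symm)
        measurableSet_Iic
    rw [← setIntegral_univ, ← Iic_union_Ioi (a := (0 : ℝ)),
      setIntegral_union (Iic_disjoint_Ioi le_rfl) measurableSet_Ioi i2 i1,
      setIntegral_congr_fun measurableSet_Iic e2, setIntegral_congr_fun measurableSet_Ioi e1,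
      integral_mul_const, integral_mul_const, h1, h2, hmass]
    ring
  rw [← hmint]
  refine tendsto_integral_filter_of_dominated_convergence (fun x => ‖k x‖ * B) ?_ ?_
    (hk.norm.mul_const B) ?_
  · filter_upwards [eventually_gt_atTop 0] with Y hY
    exact hk.aestronglyMeasurable.mul ((hh.comp_sub_left τ).comp_div hY.ne').aestronglyMeasurable
  · refine Eventually.of_forall fun Y => ae_of_all _ fun x => ?_
    rw [norm_mul]
    gcongr
    exact hB _
  · have hne : ∀ᵐ x : ℝ, x ≠ 0 := by simp [ae_iff]
    filter_upwards [hne] with x hx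
    have hlim : Tendsto (fun Y : ℝ => τ - x / Y) atTop (𝓝 τ) := by
      have h0 : Tendsto (fun Y : ℝ => x / Y) atTop (𝓝 0) := tendsto_const_nhds.div_atTop tendsto_id
      simpa using h0.const_sub τ
    refine Tendsto.const_mul _ ?_
    rcases hx.lt_or_gt with hx | hx
    · rw [if_neg (not_lt.2 hx.le)]
      refine hr.comp (tendsto_nhdsWithin_iff.2 ⟨hlim, ?_⟩)
      filter_upwards [eventually_gt_atTop 0] with Y hY
      have := div_neg_of_neg_of_pos hx hY
      simp only [mem_Ioi]; linarith
    · rw [if_pos hx]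
      refine hl.comp (tendsto_nhdsWithin_iff.2 ⟨hlim, ?_⟩)
      filter_upwards [eventually_gt_atTop 0] with Y hY
      have := div_pos hx hY
      simp only [mem_Iio]; linarith

theorem fourier_comp_sub_div (h : ℝ → ℂ) (τ : ℝ) {Y : ℝ} (hY : 0 < Y) (ξ : ℝ) :
    𝓕 (fun x => h (τ - x / Y)) ξ =
      Y * Complex.exp (2 * Real.pi * (-Y * ξ) * τ * Complex.I) * 𝓕 h (-Y * ξ) := by
  rw [Real.fourier_real_eq_integral_exp_smul, Real.fourier_real_eq_integral_exp_smul]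
  set F : ℝ → ℂ := fun u =>
    Complex.exp (((-2 * Real.pi * (Y * (τ - u)) * ξ : ℝ) : ℂ) * Complex.I) • h u with hF
  have e : (fun x : ℝ => Complex.exp (((-2 * Real.pi * x * ξ : ℝ) : ℂ) * Complex.I) •
      h (τ - x / Y)) = fun x => F (τ - x / Y) := by
    ext x
    simp only [hF]
    congr 5
    field_simp
    ring
  have e' := Measure.integral_comp_div (fun x => F (τ - x)) Y
  rw [e, e', integral_sub_left_eq_self F volume τ,
    abs_of_pos hY, Complex.real_smul, mul_assoc]
  congr 1
  rw [← integral_const_mul]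
  refine integral_congr_ae (ae_of_all _ fun u => ?_)
  simp only [hF, smul_eq_mul]
  rw [← mul_assoc (Complex.exp _) (Complex.exp _) (h u), ← Complex.exp_add]
  congr 2
  push_cast
  ring

/-- The multiplication formula moves the transform from `w` to the dilated `h`; evenness of `w`
absorbs the sign in the substitution `η = -Yξ`. It identifies the smoothly cut inversion integral
with a kernel average. -/
theorem integral_fourier_mul_comp_sub_div {w : ℝ → ℂ} (hw : Integrable w)
    (heven : ∀ x, w (-x) = w x) {h : ℝ → ℂ} (hh : Integrable h) (τ : ℝ) {Y : ℝ} (hY : 0 < Y) :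
    ∫ x, 𝓕 w x * h (τ - x / Y) =
      ∫ η, w (η / Y) * (Complex.exp (2 * Real.pi * η * τ * Complex.I) * 𝓕 h η) := by
  have hg : Integrable (fun x => h (τ - x / Y)) := (hh.comp_sub_left τ).comp_div hY.ne'
  have flip := VectorFourier.integral_fourierIntegral_smul_eq_flip (L := innerₗ ℝ)
    Real.continuous_fourierChar continuous_inner hw hg
  have flip' : ∫ x, 𝓕 w x * h (τ - x / Y) = ∫ ξ, w ξ * 𝓕 (fun x => h (τ - x / Y)) ξ := by
    simpa [flip_innerₗ] using! flip
  rw [flip']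
  set Φ : ℝ → ℂ := fun η =>
    w (η / Y) * (Complex.exp (2 * Real.pi * η * τ * Complex.I) * 𝓕 h η) with hΦ
  have e : (fun ξ : ℝ => w ξ * 𝓕 (fun x => h (τ - x / Y)) ξ) = fun ξ => (Y : ℂ) * Φ (-Y * ξ) := by
    ext ξ
    rw [fourier_comp_sub_div h τ hY ξ]
    have : -Y * ξ / Y = -ξ := by field_simp
    simp only [hΦ, this, heven]
    push_cast
    ring
  rw [e, integral_const_mul, Measure.integral_comp_mul_left Φ (-Y), abs_inv, abs_neg,
    abs_of_pos hY, Complex.real_smul]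
  push_cast
  rw [mul_inv_cancel_left₀ (by exact_mod_cast hY.ne')]

/-- The Tauberian step: smoothing the cutoff changes the truncated integral of a function of size
`C / |η|` by at most `2 C (lam - 1)`. -/
theorem norm_integral_cutoff_sub_le {w : ℝ → ℝ} {lam C Y : ℝ} {ψ : ℝ → ℂ} (hlam : 1 < lam)
    (hw : Continuous w) (h1 : ∀ x, |x| ≤ 1 → w x = 1) (h0 : ∀ x, lam ≤ |x| → w x = 0)
    (hnn : ∀ x, 0 ≤ w x) (hle : ∀ x, w x ≤ 1) (hψ : Continuous ψ)
    (hψC : ∀ η, |η| * ‖ψ η‖ ≤ C) (hY : 0 < Y) :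
    ‖(∫ η, (w (η / Y) : ℂ) * ψ η) - ∫ η in (-Y)..Y, ψ η‖ ≤ 2 * C * (lam - 1) := by
  have hC : 0 ≤ C := by simpa using hψC 0
  have hsup : ∀ η, lam * Y ≤ |η| → w (η / Y) = 0 := fun η hη => h0 _ (by
    rw [abs_div, abs_of_pos hY, le_div_iff₀ hY]; exact hη)
  have hint1 : Integrable fun η => (w (η / Y) : ℂ) * ψ η := by
    refine Continuous.integrable_of_hasCompactSupport (by fun_prop) ?_
    refine HasCompactSupport.intro (isCompact_Icc (a := -(lam * Y)) (b := lam * Y)) fun x hx => ?_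
    rw [hsup x, Complex.ofReal_zero, zero_mul]
    by_contra! hlt
    exact hx ⟨(abs_lt.1 hlt).1.le, (abs_lt.1 hlt).2.le⟩
  have hint2 : Integrable ((Ioc (-Y) Y).indicator ψ) :=
    (integrable_indicator_iff measurableSet_Ioc).2
      ((hψ.integrableOn_Icc).mono_set Ioc_subset_Icc_self)
  rw [intervalIntegral.integral_of_le (by linarith), ← integral_indicator measurableSet_Ioc,
    ← integral_sub hint1 hint2]
  -- The two transition zones, each of length `(lam - 1) Y`; there the integrand is at most `C / Y`.
  -- The endpoint `-Y`, absent from `Ioc`, falls in `A`.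
  set A : Set ℝ := Icc (-(lam * Y)) (-Y)
  set D : Set ℝ := Icc Y (lam * Y)
  have hc : ∀ s : Set ℝ, MeasurableSet s → volume s ≠ ⊤ →
      Integrable (s.indicator fun _ : ℝ => C / Y) := fun s hs hv =>
    (integrable_indicator_iff hs).2 (integrableOn_const hv)
  have iA := hc A measurableSet_Icc (by simp [A])
  have iD := hc D measurableSet_Icc (by simp [D])
  have hYl : Y ≤ lam * Y := by nlinarith
  calc _ ≤ ∫ η, A.indicator (fun _ : ℝ => C / Y) η + D.indicator (fun _ : ℝ => C / Y) η := by
        refine norm_integral_le_of_norm_le (iA.add iD) (ae_of_all _ fun η => ?_)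
        have nA : 0 ≤ A.indicator (fun _ : ℝ => C / Y) η :=
          indicator_nonneg (fun _ _ => by positivity) _
        have nD : 0 ≤ D.indicator (fun _ : ℝ => C / Y) η :=
          indicator_nonneg (fun _ _ => by positivity) _
        rcases lt_or_ge (lam * Y) |η| with hbig | hsmall
        · rw [hsup η hbig.le, indicator_of_notMem]
          · simpa using add_nonneg nA nD
          · intro hmem
            have := abs_le.2 ⟨hmem.1.le, hmem.2⟩
            linarith
        · have hb := abs_le.1 hsmall
          by_cases hin : η ∈ Ioc (-Y) Y
          · rw [indicator_of_mem hin, h1]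
            · simpa using add_nonneg nA nD
            · rw [abs_div, abs_of_pos hY, div_le_one hY]
              exact abs_le.2 ⟨hin.1.le, hin.2⟩
          · rw [indicator_of_notMem hin, sub_zero, norm_mul, Complex.norm_real,
              Real.norm_of_nonneg (hnn _)]
            have hYη : Y ≤ |η| := by
              by_contra! hlt
              exact hin ⟨(abs_lt.1 hlt).1, (abs_lt.1 hlt).2.le⟩
            have hψη : ‖ψ η‖ ≤ C / Y := by
              rw [le_div_iff₀ hY]
              calc ‖ψ η‖ * Y ≤ ‖ψ η‖ * |η| := by gcongr
                _ ≤ C := by rw [mul_comm]; exact hψC η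
            have hone : C / Y ≤ A.indicator (fun _ : ℝ => C / Y) η +
                D.indicator (fun _ : ℝ => C / Y) η := by
              rcases le_abs.1 hYη with h | h
              · rw [indicator_of_mem (s := D) ⟨h, hb.2⟩]; linarith
              · rw [indicator_of_mem (s := A) ⟨hb.1, by linarith⟩]; linarith
            calc w (η / Y) * ‖ψ η‖ ≤ 1 * ‖ψ η‖ := by gcongr; exact hle _
              _ ≤ _ := by rw [one_mul]; exact hψη.trans hone
    _ = 2 * C * (lam - 1) := by
        rw [integral_add iA iD, integral_indicator measurableSet_Icc,
          integral_indicator measurableSet_Icc, setIntegral_const, setIntegral_const]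
        simp only [Real.volume_real_Icc, smul_eq_mul]
        rw [max_eq_left (by linarith), max_eq_left (by linarith)]
        field_simp
        ring

/-- Pointwise Fourier inversion at a point with one-sided limits, for a bounded integrable function
whose Fourier transform is `O(1 / |ξ|)`. -/
theorem tendsto_integral_exp_mul_fourier {h : ℝ → ℂ} {τ B C : ℝ} {l r : ℂ} (hh : Integrable h)
    (hB : ∀ u, ‖h u‖ ≤ B) (hl : Tendsto h (𝓝[<] τ) (𝓝 l)) (hr : Tendsto h (𝓝[>] τ) (𝓝 r))
    (hC : ∀ ξ, |ξ| * ‖𝓕 h ξ‖ ≤ C) :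
    Tendsto (fun Y : ℝ => ∫ ξ in (-Y)..Y,
      Complex.exp (2 * Real.pi * ξ * τ * Complex.I) * 𝓕 h ξ) atTop (𝓝 ((l + r) / 2)) := by
  have hC0 : 0 ≤ C := by simpa using hC 0
  have hcont : Continuous (𝓕 h) := VectorFourier.fourierIntegral_continuous
    Real.continuous_fourierChar continuous_inner hh
  set ψ : ℝ → ℂ := fun ξ => Complex.exp (2 * Real.pi * ξ * τ * Complex.I) * 𝓕 h ξ with hψ
  have hψc : Continuous ψ := by fun_prop
  have hψn : ∀ ξ, |ξ| * ‖ψ ξ‖ ≤ C := fun ξ => by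
    have : (2 * Real.pi * ξ * τ * Complex.I : ℂ) = ((2 * Real.pi * ξ * τ : ℝ) : ℂ) * Complex.I := by
      push_cast; ring
    rw [hψ]
    simp only
    rw [norm_mul, this, Complex.norm_exp_ofReal_mul_I, one_mul]
    exact hC ξ
  rw [Metric.tendsto_atTop']
  intro ε hε
  -- Chosen so that `2C (lam - 1) ≤ ε/2`; `C + 1` avoids dividing by zero.
  set lam : ℝ := 1 + ε / (4 * (C + 1)) with hlam
  have hlam1 : 1 < lam := by
    rw [hlam]
    have : 0 < ε / (4 * (C + 1)) := by positivity
    linarith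
  obtain ⟨w, hwc, heven, h1, h0, hnn, hle, hwint, hkint, hmass⟩ := exists_cutoff hlam1
  have hevenC : ∀ x, (w (-x) : ℂ) = w x := fun x => by rw [heven]
  have hker := tendsto_integral_even_kernel hkint (fourier_even hevenC) hmass hh hB hl hr
  obtain ⟨N, hN⟩ := (Metric.tendsto_atTop'.1 hker) (ε / 2) (by positivity)
  refine ⟨max N 0, fun Y hY => ?_⟩
  have hY0 : 0 < Y := lt_of_le_of_lt (le_max_right _ _) hY
  have hd := hN Y (lt_of_le_of_lt (le_max_left _ _) hY)
  rw [integral_fourier_mul_comp_sub_div hwint hevenC hh τ hY0] at hd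
  have ht := norm_integral_cutoff_sub_le hlam1 hwc h1 h0 hnn hle hψc hψn hY0
  have hsmall : 2 * C * (lam - 1) ≤ ε / 2 := by
    rw [hlam, add_sub_cancel_left, mul_div_assoc', div_le_div_iff₀ (by positivity) (by positivity)]
    nlinarith
  calc dist (∫ ξ in (-Y)..Y, ψ ξ) ((l + r) / 2)
      ≤ dist (∫ ξ in (-Y)..Y, ψ ξ) (∫ η, (w (η / Y) : ℂ) * ψ η) +
        dist (∫ η, (w (η / Y) : ℂ) * ψ η) ((l + r) / 2) := dist_triangle _ _ _
    _ < ε / 2 + ε / 2 := by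
        refine add_lt_add_of_le_of_lt ?_ hd
        rw [dist_comm, dist_eq_norm]
        exact ht.trans hsmall
    _ = ε := by ring

end FourierInversion

/-! ### The conformable transform as a Fourier transform, and the Bromwich formula. -/

section ConformableTransform
open MeasureTheory FourierTransform

theorem conformableTime_pos {α t : ℝ} (hα : 0 < α) (ht : 0 < t) : 0 < t ^ α / α :=
  div_pos (Real.rpow_pos_of_pos ht α) hα

theorem conformableTime_inv {α u : ℝ} (hα : 0 < α) (hu : 0 < u) :
    ((α * u) ^ (1 / α)) ^ α / α = u := by
  rw [← Real.rpow_mul (by positivity), one_div_mul_cancel hα.ne', Real.rpow_one]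
  field_simp

theorem conformableTime_leftInv {α t : ℝ} (hα : 0 < α) (ht : 0 < t) :
    (α * (t ^ α / α)) ^ (1 / α) = t := by
  rw [mul_div_cancel₀ _ hα.ne', ← Real.rpow_mul ht.le, mul_one_div_cancel hα.ne', Real.rpow_one]

/-- In the variable `u = t ^ α / α` the conformable Laplace transform is the usual one. -/
theorem conformableLaplace_eq {α : ℝ} (hα : 0 < α) (f : ℝ → ℝ) (s : ℂ) :
    conformableLaplace α f s =
      ∫ u in Ioi (0 : ℝ), Complex.exp (-s * u) * (f ((α * u) ^ (1 / α)) : ℂ) := by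
  set G : ℝ → ℂ := fun v =>
    (1 / α : ℂ) * (Complex.exp (-s * ((v / α : ℝ) : ℂ)) * (f (v ^ (1 / α)) : ℂ)) with hG
  have h1 := integral_comp_rpow_Ioi_of_pos (g := G) hα
  have h2 := integral_comp_mul_left_Ioi' G 0 hα
  have hαc : (α : ℂ) ≠ 0 := by exact_mod_cast hα.ne'
  rw [mul_zero, ← h1] at h2
  have e1 : conformableLaplace α f s =
      ∫ x in Ioi (0 : ℝ), (α * x ^ (α - 1)) • G (x ^ α) := by
    refine setIntegral_congr_fun measurableSet_Ioi fun x hx => ?_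
    have hx0 : (0 : ℝ) < x := hx
    have : (x ^ α) ^ (1 / α) = x := by
      rw [← Real.rpow_mul hx0.le, mul_one_div_cancel hα.ne', Real.rpow_one]
    simp only [hG, this, Complex.real_smul]
    push_cast
    field_simp
  rw [e1, ← h2, ← integral_smul]
  refine setIntegral_congr_fun measurableSet_Ioi fun u _ => ?_
  have : α * u / α = u := by field_simp
  simp only [hG, this, Complex.real_smul]
  field_simp

theorem PiecewiseContinuousNonneg.countable {f : ℝ → ℝ} (hf : PiecewiseContinuousNonneg f) :
    {t : ℝ | 0 ≤ t ∧ ¬ ContinuousWithinAt f (Ici 0) t}.Countable := by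
  refine (countable_iUnion fun n : ℕ => (hf.1 n).countable).mono fun t ht => ?_
  obtain ⟨n, hn⟩ := exists_nat_ge t
  exact mem_iUnion.2 ⟨n, ⟨ht.1, hn⟩, ht.2⟩

theorem continuousAt_conformableTime_inv {α u : ℝ} (hα : 0 < α) (hu : 0 < u) :
    ContinuousAt (fun u : ℝ => (α * u) ^ (1 / α)) u :=
  ContinuousAt.rpow_const (by fun_prop) (Or.inl (by positivity))

/-- The composite is continuous off the image of the countable set of discontinuities, which is a
null set. -/
theorem PiecewiseContinuousNonneg.aestronglyMeasurable_comp {α : ℝ} (hα : 0 < α) {f : ℝ → ℝ}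
    (hf : PiecewiseContinuousNonneg f) :
    AEStronglyMeasurable (fun u : ℝ => (f ((α * u) ^ (1 / α)) : ℂ)) (volume.restrict (Ioi 0)) := by
  set D := (fun t : ℝ => t ^ α / α) '' {t : ℝ | 0 ≤ t ∧ ¬ ContinuousWithinAt f (Ici 0) t}
  have hD : D.Countable := hf.countable.image _
  have hcont : ContinuousOn (fun u : ℝ => (f ((α * u) ^ (1 / α)) : ℂ)) (Ioi 0 \ D) := by
    rintro u ⟨hu, huD⟩
    have hu0 : (0 : ℝ) < u := hu
    have hq : 0 < (α * u) ^ (1 / α) := Real.rpow_pos_of_pos (by positivity) _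
    have hfc : ContinuousAt f ((α * u) ^ (1 / α)) := by
      by_contra hn
      refine huD ⟨_, ⟨hq.le, fun h => hn (h.continuousAt (Ici_mem_nhds hq))⟩, ?_⟩
      exact conformableTime_inv hα hu0
    have h2 : ContinuousAt (fun u : ℝ => f ((α * u) ^ (1 / α))) u :=
      ContinuousAt.comp (f := fun u : ℝ => (α * u) ^ (1 / α)) hfc
        (continuousAt_conformableTime_inv hα hu0)
    exact (Complex.continuous_ofReal.continuousAt.comp h2).continuousWithinAt
  have := hcont.aestronglyMeasurable (μ := volume) (measurableSet_Ioi.diff hD.measurableSet)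
  rwa [Measure.restrict_congr_set (sdiff_null_ae_eq_self (hD.measure_zero volume))] at this

theorem ConformableExpOrder.exists_bound {α a : ℝ} (hα : 0 < α) {f : ℝ → ℝ}
    (hf : ConformableExpOrder α a f) :
    ∃ M : ℝ, 0 ≤ M ∧ ∀ u : ℝ, 0 < u → |f ((α * u) ^ (1 / α))| ≤ M * Real.exp (a * u) := by
  obtain ⟨M, hM⟩ := hf
  refine ⟨|M|, abs_nonneg _, fun u hu => ?_⟩
  have := hM ((α * u) ^ (1 / α)) (Real.rpow_nonneg (by positivity) _)
  rw [conformableTime_inv hα hu] at this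
  exact this.trans (by gcongr; exact le_abs_self M)

/-- Continuity suffices for the holomorphy needed later: a meromorphic function continuous at a
point is analytic there. -/
theorem continuousAt_conformableLaplace {α a : ℝ} (hα : 0 < α) {f : ℝ → ℝ}
    (hpc : PiecewiseContinuousNonneg f) (hexp : ConformableExpOrder α a f) {s₀ : ℂ}
    (hs : a < s₀.re) : ContinuousAt (conformableLaplace α f) s₀ := by
  obtain ⟨M, hM0, hM⟩ := hexp.exists_bound hα
  -- The gap between `a` and `b` gives a single integrable bound for all `s` near `s₀`.
  obtain ⟨b, hab, hbs⟩ := exists_between hs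
  rw [show conformableLaplace α f = fun s => ∫ u in Ioi (0 : ℝ),
    Complex.exp (-s * u) * (f ((α * u) ^ (1 / α)) : ℂ) from funext (conformableLaplace_eq hα f)]
  refine continuousAt_of_dominated (bound := fun u => M * Real.exp (-(b - a) * u)) ?_ ?_ ?_ ?_
  · exact Eventually.of_forall fun s => AEStronglyMeasurable.mul
      (by fun_prop) (hpc.aestronglyMeasurable_comp hα)
  · have hre : ∀ᶠ s : ℂ in 𝓝 s₀, b < s.re :=
      Complex.continuous_re.continuousAt.eventually (lt_mem_nhds hbs)
    filter_upwards [hre] with s hs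
    filter_upwards [ae_restrict_mem measurableSet_Ioi] with u hu
    have hu0 : (0 : ℝ) < u := hu
    rw [norm_mul, Complex.norm_exp, Complex.norm_real, Real.norm_eq_abs]
    calc Real.exp (-s * u : ℂ).re * |f ((α * u) ^ (1 / α))|
        ≤ Real.exp (-b * u) * (M * Real.exp (a * u)) := by
          gcongr
          · simp only [Complex.re_mul_ofReal, Complex.neg_re]
            gcongr
          · exact hM u hu0
      _ = M * Real.exp (-(b - a) * u) := by
          rw [mul_left_comm, ← Real.exp_add]; ring_nf
  · exact (exp_neg_integrableOn_Ioi 0 (sub_pos.2 hab)).const_mul M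
  · exact ae_of_all _ fun u => by fun_prop

/-- The damped original function in the variable `u = t ^ α / α`, extended by zero. -/
noncomputable def dampedOriginal (α c : ℝ) (f : ℝ → ℝ) : ℝ → ℂ :=
  (Ioi (0 : ℝ)).indicator fun u => Complex.exp (-c * u) * (f ((α * u) ^ (1 / α)) : ℂ)

theorem dampedOriginal_of_pos {α c u : ℝ} (f : ℝ → ℝ) (hu : 0 < u) :
    dampedOriginal α c f u = Complex.exp (-c * u) * (f ((α * u) ^ (1 / α)) : ℂ) :=
  indicator_of_mem (mem_Ioi.2 hu) _

theorem norm_dampedOriginal_le {α a c M : ℝ} {f : ℝ → ℝ}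
    (hM : ∀ u : ℝ, 0 < u → |f ((α * u) ^ (1 / α))| ≤ M * Real.exp (a * u)) {u : ℝ} (hu : 0 < u) :
    ‖Complex.exp (-c * u) * (f ((α * u) ^ (1 / α)) : ℂ)‖ ≤ M * Real.exp (-(c - a) * u) := by
  rw [norm_mul, Complex.norm_exp, Complex.norm_real, Real.norm_eq_abs]
  have : (-c * u : ℂ).re = -c * u := by simp
  rw [this]
  calc Real.exp (-c * u) * |f ((α * u) ^ (1 / α))|
      ≤ Real.exp (-c * u) * (M * Real.exp (a * u)) := by gcongr; exact hM u hu
    _ = M * Real.exp (-(c - a) * u) := by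
        rw [mul_left_comm, ← Real.exp_add]; ring_nf

theorem integrable_dampedOriginal {α a c : ℝ} (hα : 0 < α) {f : ℝ → ℝ}
    (hpc : PiecewiseContinuousNonneg f) (hexp : ConformableExpOrder α a f) (hac : a < c) :
    Integrable (dampedOriginal α c f) := by
  obtain ⟨M, hM0, hM⟩ := hexp.exists_bound hα
  refine (integrable_indicator_iff measurableSet_Ioi).2 ?_
  refine Integrable.mono' ((exp_neg_integrableOn_Ioi 0 (sub_pos.2 hac)).const_mul M)
    (AEStronglyMeasurable.mul (by fun_prop) (hpc.aestronglyMeasurable_comp hα)) ?_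
  filter_upwards [ae_restrict_mem measurableSet_Ioi] with u hu
  exact norm_dampedOriginal_le hM hu

theorem exists_bound_dampedOriginal {α a c : ℝ} (hα : 0 < α) {f : ℝ → ℝ}
    (hexp : ConformableExpOrder α a f) (hac : a < c) :
    ∃ M : ℝ, ∀ u, ‖dampedOriginal α c f u‖ ≤ M := by
  obtain ⟨M, hM0, hM⟩ := hexp.exists_bound hα
  refine ⟨M, fun u => ?_⟩
  by_cases hu : 0 < u
  · rw [dampedOriginal_of_pos f hu]
    refine (norm_dampedOriginal_le hM hu).trans (mul_le_of_le_one_right hM0 ?_)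
    rw [Real.exp_le_one_iff]
    nlinarith
  · rw [dampedOriginal, indicator_of_notMem (by simpa using hu), norm_zero]
    exact hM0

theorem fourier_dampedOriginal {α : ℝ} (hα : 0 < α) (f : ℝ → ℝ) (c ξ : ℝ) :
    𝓕 (dampedOriginal α c f) ξ =
      conformableLaplace α f (c + ((2 * Real.pi * ξ : ℝ) : ℂ) * Complex.I) := by
  rw [conformableLaplace_eq hα, Real.fourier_real_eq_integral_exp_smul,
    ← integral_indicator measurableSet_Ioi]
  congr 1
  ext u
  by_cases hu : u ∈ Ioi (0 : ℝ)
  · rw [dampedOriginal, indicator_of_mem hu, indicator_of_mem hu, smul_eq_mul, ← mul_assoc,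
      ← Complex.exp_add]
    congr 2
    push_cast
    ring
  · rw [dampedOriginal, indicator_of_notMem hu, indicator_of_notMem hu, smul_zero]

/-- Used with `S` and `T` both left or both right half-lines: the change of variable is increasing
and so preserves sides. -/
theorem tendsto_dampedOriginal {α c t v : ℝ} (hα : 0 < α) (ht : 0 < t) {f : ℝ → ℝ} {S T : Set ℝ}
    (hf : Tendsto f (𝓝[T] t) (𝓝 v))
    (hST : ∀ u ∈ S, 0 < u → (α * u) ^ (1 / α) ∈ T) :
    Tendsto (dampedOriginal α c f) (𝓝[S] (t ^ α / α))
      (𝓝 (Complex.exp (-c * ((t ^ α / α : ℝ) : ℂ)) * v)) := by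
  have hτ := conformableTime_pos hα ht
  have hpos : ∀ᶠ u in 𝓝[S] (t ^ α / α), 0 < u :=
    (lt_mem_nhds hτ).filter_mono nhdsWithin_le_nhds
  have hq : Tendsto (fun u : ℝ => (α * u) ^ (1 / α)) (𝓝[S] (t ^ α / α)) (𝓝[T] t) := by
    refine tendsto_nhdsWithin_iff.2 ⟨?_, ?_⟩
    · have := (continuousAt_conformableTime_inv hα hτ).tendsto
      rw [conformableTime_leftInv hα ht] at this
      exact this.mono_left nhdsWithin_le_nhds
    · filter_upwards [hpos, self_mem_nhdsWithin] with u hu huS using hST u huS hu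
  have he : Tendsto (fun u : ℝ => Complex.exp (-c * u)) (𝓝[S] (t ^ α / α))
      (𝓝 (Complex.exp (-c * ((t ^ α / α : ℝ) : ℂ)))) :=
    (Continuous.tendsto (by fun_prop) _).mono_left nhdsWithin_le_nhds
  refine (he.mul ((Complex.continuous_ofReal.tendsto v).comp (hf.comp hq))).congr' ?_
  filter_upwards [hpos] with u hu
  rw [dampedOriginal_of_pos f hu]
  rfl

theorem conformableTime_inv_lt_iff {α t u : ℝ} (hα : 0 < α) (ht : 0 < t) (hu : 0 < u) :
    (α * u) ^ (1 / α) < t ↔ u < t ^ α / α := by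
  conv_lhs => rw [← conformableTime_leftInv hα ht]
  rw [Real.rpow_lt_rpow_iff (by positivity) (by positivity) (by positivity)]
  exact mul_lt_mul_iff_right₀ hα

theorem lt_conformableTime_inv_iff {α t u : ℝ} (hα : 0 < α) (ht : 0 < t) (hu : 0 < u) :
    t < (α * u) ^ (1 / α) ↔ t ^ α / α < u := by
  conv_lhs => rw [← conformableTime_leftInv hα ht]
  rw [Real.rpow_lt_rpow_iff (by positivity) (by positivity) (by positivity)]
  exact mul_lt_mul_iff_right₀ hα

/-- The Bromwich form of the conformable inversion formula under `F(s) = O(1 / |s|)`. -/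
theorem tendsto_bromwich {α a c t K : ℝ} (hα : 0 < α) {f : ℝ → ℝ}
    (hpc : PiecewiseContinuousNonneg f) (hexp : ConformableExpOrder α a f) (hac : a < c)
    (hK : ∀ s : ℂ, s.re = c → ‖s‖ * ‖conformableLaplace α f s‖ ≤ K) (ht : 0 < t)
    (hn : IsNormalizedAt f t) :
    Tendsto (fun Y : ℝ => (2 * Real.pi * Complex.I)⁻¹ * ∫ y in (-Y)..Y, Complex.I *
      (Complex.exp ((c + y * Complex.I) * ((t ^ α / α : ℝ) : ℂ)) *
        conformableLaplace α f (c + y * Complex.I))) atTop (𝓝 (f t : ℂ)) := by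
  obtain ⟨l, r, hl, hr, hlr⟩ := hn
  obtain ⟨B, hB⟩ := exists_bound_dampedOriginal hα hexp hac
  set τ := t ^ α / α with hτ
  have hl' := tendsto_dampedOriginal (c := c) (S := Iio τ) hα ht hl
    fun u hu hu0 => (conformableTime_inv_lt_iff hα ht hu0).2 hu
  have hr' := tendsto_dampedOriginal (c := c) (S := Ioi τ) hα ht hr
    fun u hu hu0 => (lt_conformableTime_inv_iff hα ht hu0).2 hu
  have hdecay : ∀ ξ, |ξ| * ‖𝓕 (dampedOriginal α c f) ξ‖ ≤ K := by
    intro ξ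
    rw [fourier_dampedOriginal hα]
    refine le_trans ?_ (hK (c + ((2 * Real.pi * ξ : ℝ) : ℂ) * Complex.I) (by simp))
    gcongr
    have h1 := Complex.abs_im_le_norm (c + ((2 * Real.pi * ξ : ℝ) : ℂ) * Complex.I)
    have h2 : (c + ((2 * Real.pi * ξ : ℝ) : ℂ) * Complex.I).im = 2 * Real.pi * ξ := by
      simp
    rw [h2, abs_mul, abs_of_pos Real.two_pi_pos] at h1
    refine le_trans ?_ h1
    have := Real.two_le_pi
    nlinarith [abs_nonneg ξ]
  have key := tendsto_integral_exp_mul_fourier (τ := τ) (integrable_dampedOriginal hα hpc hexp hac) hB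
    hl' hr' hdecay
  -- Frequency `ξ` corresponds to height `2πξ` on the line `Re s = c`, so the cutoff `Y` in height
  -- is `Y / (2π)` in frequency.
  have hscale : Tendsto (fun Y : ℝ => Y / (2 * Real.pi)) atTop atTop :=
    tendsto_id.atTop_div_const Real.two_pi_pos
  have key2 := (key.comp hscale).const_mul (Complex.exp (c * τ))
  have hval : Complex.exp (c * τ) * ((Complex.exp (-c * τ) * l + Complex.exp (-c * τ) * r) / 2) =
      (f t : ℂ) := by
    have : Complex.exp (c * τ) * Complex.exp (-c * τ) = 1 := by
      rw [← Complex.exp_add]; simp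
    rw [hlr]
    push_cast
    linear_combination ((l : ℂ) + r) / 2 * this
  rw [hval] at key2
  refine key2.congr fun Y => ?_
  simp only [Function.comp_apply]
  set Ψ : ℝ → ℂ := fun y => Complex.exp ((c + y * Complex.I) * (τ : ℂ)) *
    conformableLaplace α f (c + y * Complex.I) with hΨ
  have e : ∀ ξ : ℝ, Complex.exp (2 * Real.pi * ξ * τ * Complex.I) *
      𝓕 (dampedOriginal α c f) ξ = Complex.exp (-c * τ) * Ψ (2 * Real.pi * ξ) := by
    intro ξ
    rw [fourier_dampedOriginal hα, hΨ]
    simp only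
    rw [← mul_assoc, ← Complex.exp_add]
    congr 2
    push_cast
    ring
  simp_rw [e]
  rw [intervalIntegral.integral_const_mul, intervalIntegral.integral_const_mul,
    intervalIntegral.integral_comp_mul_left Ψ Real.two_pi_pos.ne', ← mul_assoc, ← Complex.exp_add,
    mul_neg, mul_div_cancel₀ _ Real.two_pi_pos.ne', ← mul_assoc, Complex.real_smul]
  have h1 : (2 * Real.pi * Complex.I : ℂ)⁻¹ * Complex.I = (2 * Real.pi)⁻¹ := by
    rw [mul_inv, mul_assoc, inv_mul_cancel₀ Complex.I_ne_zero, mul_one]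
    push_cast
    rfl
  rw [h1]
  simp [hΨ]

end ConformableTransform

/-! ### From Bromwich integrals to residue sums. -/

/-- Rotating a nonzero point slightly stays in its punctured neighbourhood. -/
theorem tendsto_rotation_nhdsNE {z : ℂ} (hz : z ≠ 0) :
    Tendsto (fun δ : ℝ => z * Complex.exp (δ * Complex.I)) (𝓝[>] 0) (𝓝[≠] z) := by
  refine tendsto_nhdsWithin_iff.2 ⟨?_, ?_⟩
  · have : Continuous fun δ : ℝ => z * Complex.exp (δ * Complex.I) := by fun_prop
    have h := this.tendsto 0
    simp only [Complex.ofReal_zero, zero_mul, Complex.exp_zero, mul_one] at h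
    exact h.mono_left nhdsWithin_le_nhds
  · filter_upwards [Ioo_mem_nhdsGT Real.pi_pos] with δ hδ heq
    have h1 : Complex.exp (δ * Complex.I) = 1 := mul_left_cancel₀ hz (by simpa using heq)
    have h2 := congrArg Complex.im h1
    rw [Complex.exp_ofReal_mul_I_im, Complex.one_im] at h2
    exact (Real.sin_pos_of_pos_of_lt_pi hδ.1 hδ.2).ne' h2

/-- A function bounded on the arc `|s| = R`, `Re s ≤ c` has no pole on the open arc. -/
theorem meromorphicOrderAt_nonneg_of_bounded_arc {G : ℂ → ℂ} {R c B : ℝ} {z : ℂ} (hR : 0 < R)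
    (hG : ∀ s : ℂ, ‖s‖ = R → s.re ≤ c → ‖G s‖ ≤ B) (hz : ‖z‖ = R) (hzc : z.re < c) :
    0 ≤ meromorphicOrderAt G z := by
  by_contra! hneg
  have hz0 : z ≠ 0 := norm_pos_iff.1 (hz ▸ hR)
  -- The supposed pole is approached along the circle itself, where `G` is bounded; `z.re < c` keeps
  -- the nearby points on the arc.
  have hrot := tendsto_rotation_nhdsNE hz0
  have htop := tendsto_norm_cobounded_atTop.comp
    ((tendsto_cobounded_of_meromorphicOrderAt_neg hneg).comp hrot)
  have hre : ∀ᶠ δ : ℝ in 𝓝[>] 0, (z * Complex.exp (δ * Complex.I)).re < c :=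
    (Complex.continuous_re.continuousAt.tendsto.comp
      (hrot.mono_right nhdsWithin_le_nhds)).eventually (gt_mem_nhds hzc)
  obtain ⟨δ, h1, h2⟩ := ((htop.eventually (eventually_gt_atTop B)).and hre).exists
  refine absurd h1 (not_lt.2 (hG _ ?_ h2.le))
  rw [norm_mul, Complex.norm_exp_ofReal_mul_I, mul_one, hz]

theorem meromorphicOrderAt_exp_mul (G : ℂ → ℂ) (τ : ℂ) (z : ℂ) :
    meromorphicOrderAt (fun s => Complex.exp (s * τ) * G s) z = meromorphicOrderAt G z := by
  have : (fun s => Complex.exp (s * τ) * G s) = (fun s => Complex.exp (s * τ)) * G := rfl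
  rw [this]
  exact meromorphicOrderAt_mul_of_ne_zero (by fun_prop) (Complex.exp_ne_zero _)

/-- The residue sum over `|z| < R` differs from the Bromwich integral over the chord of `|s| = R`
on `Re s = c` by the contribution of the left arc. -/
theorem norm_finsum_residueAt_sub_chord_le {G : ℂ → ℂ} {a c R τ ε : ℝ} (hG : Meromorphic G)
    (han : ∀ s : ℂ, a < s.re → AnalyticAt ℂ G s) (hac : a < c) (hR : 0 < R) (hcR : |c| ≤ R)
    (hτ : 0 < τ) (harc : ∀ s : ℂ, ‖s‖ = R → s.re ≤ c → ‖G s‖ ≤ ε) :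
    ‖(∑ᶠ z ∈ poleSet G ∩ Metric.ball 0 R,
        residueAt (fun s => Complex.exp (s * (τ : ℂ)) * G s) z) -
      (2 * Real.pi * Complex.I)⁻¹ * ∫ y in (-√(R ^ 2 - c ^ 2))..(√(R ^ 2 - c ^ 2)), Complex.I *
        (Complex.exp ((c + y * Complex.I) * (τ : ℂ)) * G (c + y * Complex.I))‖ ≤
      ε * (Real.exp (2 * τ * |c|) / τ) := by
  set g : ℂ → ℂ := fun s => Complex.exp (s * (τ : ℂ)) * G s with hg
  have hfin := hG.finite_poleSet_inter_ball R
  have hgm : Meromorphic g := fun z => MeromorphicAt.mul (by fun_prop) (hG z)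
  have hgd : ∀ s : ℂ, a < s.re → DifferentiableAt ℂ g s := fun s hs =>
    DifferentiableAt.mul (by fun_prop) (han s hs).differentiableAt
  have hord : ∀ z ∈ Metric.closedBall (0 : ℂ) R, z ∉ hfin.toFinset →
      0 ≤ meromorphicOrderAt g z := by
    intro z hz hzS
    rw [hg, meromorphicOrderAt_exp_mul]
    by_contra! hneg
    have hznb : z ∉ Metric.ball (0 : ℂ) R := fun hb =>
      hzS (hfin.mem_toFinset.2 ⟨hneg, hb⟩)
    have hzn : ‖z‖ = R := le_antisymm (by simpa using hz) (by simpa using hznb)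
    -- A pole on the circle has real part at most `a < c`, so it would lie on the open left arc,
    -- where boundedness excludes it.
    have hza : z.re ≤ a := by
      by_contra! h
      exact absurd hneg (not_lt.2 (han z h).meromorphicOrderAt_nonneg)
    exact absurd hneg
      (not_lt.2 (meromorphicOrderAt_nonneg_of_bounded_arc hR harc hzn (by linarith)))
  obtain ⟨hint, hres⟩ := hgm.circleIntegral_eq_sum_residueAt (w := 0) hR hfin.toFinset
    (fun z hz => (hfin.mem_toFinset.1 hz).2) hord
  rw [circleIntegral_eq_chord_add_leftArc hac hR hcR hgd hint] at hres
  have hsum : ∑ z ∈ hfin.toFinset, residueAt g z = (2 * Real.pi * Complex.I)⁻¹ *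
      (2 * Real.pi * Complex.I * ∑ z ∈ hfin.toFinset, residueAt g z) := by
    rw [inv_mul_cancel_left₀ Complex.two_pi_I_ne_zero]
  rw [finsum_mem_eq_finite_toFinset_sum _ hfin, hsum, ← hres, mul_add, add_sub_cancel_left,
    norm_mul]
  have hleft := norm_integral_leftArc_le hτ hR hcR harc
  have hpi : ‖(2 * Real.pi * Complex.I : ℂ)⁻¹‖ = (2 * Real.pi)⁻¹ := by
    simp [abs_of_pos Real.pi_pos]
  rw [hpi]
  calc _ ≤ (2 * Real.pi)⁻¹ * (ε * (Real.exp (2 * τ * |c|) * (2 * Real.pi / τ))) := by gcongr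
    _ = ε * (Real.exp (2 * τ * |c|) / τ) := by field_simp

/-- If the partial sums over discs of a summable family converge along radii tending to infinity,
their limit is the unordered sum. -/
theorem hasSum_of_tendsto_finsum_ball {P : Set ℂ} {φ : ℂ → ℂ} {R : ℕ → ℝ} {v : ℂ}
    (hfin : ∀ ρ : ℝ, (P ∩ Metric.ball 0 ρ).Finite) (hR : Tendsto R atTop atTop)
    (ht : Tendsto (fun n => ∑ᶠ z ∈ P ∩ Metric.ball 0 (R n), φ z) atTop (𝓝 v))
    (hs : Summable fun z : P => φ z) : HasSum (fun z : P => φ z) v := by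
  classical
  obtain ⟨w, hw⟩ := hs
  -- The radii need not be monotone: each finite set of poles lies in all discs from some index on,
  -- which makes `T` cofinal.
  set T : ℕ → Finset P := fun n => (hfin (R n)).toFinset.subtype (· ∈ P)
  have hT : Tendsto T atTop atTop := by
    refine tendsto_atTop.2 fun F => ?_
    have h : ∀ᶠ n in atTop, ∀ z ∈ F, z ∈ T n := by
      refine (eventually_all_finset F).2 fun z _ => ?_
      filter_upwards [hR.eventually_gt_atTop ‖(z : ℂ)‖] with n hn
      simp only [T, Finset.mem_subtype, Set.Finite.mem_toFinset]
      exact ⟨z.2, by simpa using hn⟩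
    filter_upwards [h] with n hn using hn
  have hlim : Tendsto (fun n => ∑ z ∈ T n, φ z) atTop (𝓝 w) := hw.comp hT
  have heq : (fun n => ∑ z ∈ T n, φ z) = fun n => ∑ᶠ z ∈ P ∩ Metric.ball 0 (R n), φ z := by
    ext n
    rw [finsum_mem_eq_finite_toFinset_sum _ (hfin (R n))]
    exact Finset.sum_subtype_of_mem φ fun z hz => ((hfin (R n)).mem_toFinset.1 hz).1
  rw [heq] at hlim
  rwa [tendsto_nhds_unique ht hlim]

/-- The residue form of the conformable inversion formula, as a limit of sums over discs. -/
theorem tendsto_finsum_residueAt {α a c t : ℝ} (hα : 0 < α) {f : ℝ → ℝ}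
    (hpc : PiecewiseContinuousNonneg f) (hexp : ConformableExpOrder α a f) {G : ℂ → ℂ} {R : ℕ → ℝ}
    (hG : Meromorphic G) (hGF : ∀ s : ℂ, a < s.re → G s = conformableLaplace α f s) (hac : a < c)
    (hgrowth : ContourGrowth G c R) (ht : 0 < t) (hn : IsNormalizedAt f t) :
    Tendsto (fun n : ℕ => ∑ᶠ z ∈ poleSet G ∩ Metric.ball 0 (R n),
      residueAt (fun s => Complex.exp (s * ((t ^ α / α : ℝ) : ℂ)) * G s) z)
      atTop (𝓝 (f t : ℂ)) := by
  obtain ⟨⟨K, hK⟩, hR, harc⟩ := hgrowth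
  have hτ := conformableTime_pos hα ht
  have hopen : IsOpen {s : ℂ | a < s.re} := isOpen_lt continuous_const Complex.continuous_re
  have han : ∀ s : ℂ, a < s.re → AnalyticAt ℂ G s := fun s hs =>
    (hG s).analyticAt ((continuousAt_conformableLaplace hα hpc hexp hs).congr (by
      filter_upwards [hopen.mem_nhds hs] with z hz using (hGF z hz).symm))
  have hbrom := tendsto_bromwich hα hpc hexp hac
    (fun s hs => by rw [← hGF s (hs ▸ hac)]; exact hK s hs) ht hn
  have hGc : ∀ y : ℝ, conformableLaplace α f (c + y * Complex.I) = G (c + y * Complex.I) :=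
    fun y => (hGF _ (by simpa using hac)).symm
  simp_rw [hGc] at hbrom
  set τ := t ^ α / α
  have hY : Tendsto (fun n => √(R n ^ 2 - c ^ 2)) atTop atTop := by
    simp_rw [sub_eq_add_neg]
    exact Real.tendsto_sqrt_atTop.comp
      (tendsto_atTop_add_const_right _ _ ((tendsto_pow_atTop two_ne_zero).comp hR))
  have hchord := hbrom.comp hY
  have hdiff : Tendsto (fun n : ℕ => (∑ᶠ z ∈ poleSet G ∩ Metric.ball 0 (R n),
      residueAt (fun s => Complex.exp (s * (τ : ℂ)) * G s) z) -
      (2 * Real.pi * Complex.I)⁻¹ *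
        ∫ y in (-√(R n ^ 2 - c ^ 2))..(√(R n ^ 2 - c ^ 2)), Complex.I *
        (Complex.exp ((c + y * Complex.I) * (τ : ℂ)) * G (c + y * Complex.I))) atTop (𝓝 0) := by
    rw [Metric.tendsto_nhds]
    intro ε hε
    set A := Real.exp (2 * τ * |c|) / τ with hA
    have hA0 : 0 < A := by positivity
    filter_upwards [harc (ε / (2 * A)) (by positivity), hR.eventually_gt_atTop 0,
      hR.eventually_ge_atTop |c|] with n h1 h2 h3
    rw [dist_zero_right]
    refine (norm_finsum_residueAt_sub_chord_le hG han hac h2 h3 hτ h1).trans_lt ?_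
    rw [← hA]
    field_simp
    norm_num
  have hadd := hdiff.add hchord
  rw [zero_add] at hadd
  refine hadd.congr fun n => ?_
  simp only [Function.comp_apply]
  ring

/-! ### The example of a single simple pole, and the theorem. -/

theorem residueAt_exp_mul_one_div_sub (b τ : ℂ) :
    residueAt (fun s => Complex.exp (s * τ) * (1 / (s - b))) b = Complex.exp (b * τ) := by
  refine residueAt_eq_of_eventually ?_
  filter_upwards [self_mem_nhdsWithin] with ρ hρ
  have hd : Differentiable ℂ fun s : ℂ => Complex.exp (s * τ) := by fun_prop
  have := hd.diffContOnCl.circleIntegral_sub_inv_smul (R := ρ) (Metric.mem_ball_self (x := b) hρ)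
  simp only [smul_eq_mul] at this
  rw [← this]
  congr 1
  ext s
  rw [one_div, mul_comm]

theorem meromorphic_one_div_sub (b : ℂ) : Meromorphic fun s : ℂ => 1 / (s - b) := fun s => by
  fun_prop

theorem poleSet_one_div_sub (b : ℂ) : poleSet (fun s => 1 / (s - b)) = {b} := by
  ext z
  simp only [poleSet, mem_ofPred_eq, mem_singleton_iff]
  constructor
  · intro hz
    by_contra hne
    have : AnalyticAt ℂ (fun s : ℂ => 1 / (s - b)) z :=
      AnalyticAt.div analyticAt_const (by fun_prop) (sub_ne_zero.2 hne)
    exact absurd hz (not_lt.2 this.meromorphicOrderAt_nonneg)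
  · rintro rfl
    have : meromorphicOrderAt (fun s : ℂ => 1 / (s - z)) z = (-1 : ℤ) := by
      rw [meromorphicOrderAt_eq_int_iff (meromorphic_one_div_sub z z)]
      exact ⟨fun _ => 1, analyticAt_const, one_ne_zero, Eventually.of_forall fun s => by simp⟩
    rw [this]
    exact_mod_cast neg_one_lt_zero

theorem contourGrowth_one_div_sub {b c : ℝ} (hbc : b < c) :
    ContourGrowth (fun s => 1 / (s - b)) c (fun n => n) := by
  have hcb : 0 < c - b := sub_pos.2 hbc
  refine ⟨⟨1 + |b| / (c - b), fun s hs => ?_⟩, tendsto_natCast_atTop_atTop, fun ε hε => ?_⟩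
  · have h1 : c - b ≤ ‖s - b‖ := by
      have := (le_abs_self _).trans (Complex.abs_re_le_norm (s - b))
      simpa [hs] using this
    have h2 : ‖s‖ ≤ ‖s - b‖ + |b| := by
      have := norm_add_le (s - b) (b : ℂ)
      simpa using this
    have h3 : 0 < ‖s - b‖ := hcb.trans_le h1
    rw [norm_div, norm_one, mul_one_div, div_le_iff₀ h3]
    have h4 : |b| ≤ |b| / (c - b) * ‖s - b‖ := by
      rw [div_mul_eq_mul_div, le_div_iff₀ hcb]
      gcongr
    linarith
  · filter_upwards [tendsto_natCast_atTop_atTop.eventually_ge_atTop (|b| + 1 / ε)] with n hn s hs _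
    have h1 : (n : ℝ) - |b| ≤ ‖s - b‖ := by
      have := norm_sub_norm_le s (b : ℂ)
      rwa [hs, Complex.norm_real, Real.norm_eq_abs] at this
    have h2 : 1 / ε ≤ ‖s - b‖ := by linarith
    rw [norm_div, norm_one]
    exact (one_div_le (by positivity) ((by positivity : 0 < 1 / ε).trans_le h2)).1 h2

theorem eq_exp_of_conformableLaplace_eq_one_div_sub {α a b t : ℝ} (hα : 0 < α) {f : ℝ → ℝ}
    (hpc : PiecewiseContinuousNonneg f) (hexp : ConformableExpOrder α a f)
    (hF : ∀ s : ℂ, a < s.re → conformableLaplace α f s = 1 / (s - b)) (ht : 0 < t)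
    (hn : IsNormalizedAt f t) : f t = Real.exp (b * (t ^ α / α)) := by
  -- The line must lie to the right both of `a` and of the pole `b`, since `b ≤ a` is not assumed.
  have hac : a < max a b + 1 := by linarith [le_max_left a b]
  have hbc : b < max a b + 1 := by linarith [le_max_right a b]
  have h := tendsto_finsum_residueAt hα hpc hexp (meromorphic_one_div_sub b)
    (fun s hs => (hF s hs).symm) hac (contourGrowth_one_div_sub hbc) ht hn
  have hconst : Tendsto (fun n : ℕ => ∑ᶠ z ∈ poleSet (fun s : ℂ => 1 / (s - b)) ∩
      Metric.ball 0 (n : ℝ), residueAt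
        (fun s => Complex.exp (s * ((t ^ α / α : ℝ) : ℂ)) * (1 / (s - b))) z)
      atTop (𝓝 (Complex.exp (b * ((t ^ α / α : ℝ) : ℂ)))) := by
    refine tendsto_const_nhds.congr' ?_
    filter_upwards [tendsto_natCast_atTop_atTop.eventually_gt_atTop |b|] with n hn
    have : poleSet (fun s : ℂ => 1 / (s - b)) ∩ Metric.ball 0 (n : ℝ) = {(b : ℂ)} := by
      rw [poleSet_one_div_sub]
      exact inter_eq_left.2 (singleton_subset_iff.2 (by simpa using hn))
    rw [this, finsum_mem_singleton, residueAt_exp_mul_one_div_sub]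
  have := tendsto_nhds_unique h hconst
  exact_mod_cast this

theorem theorem4p3 (α : ℝ) (hα : 0 < α) (a : ℝ) (f : ℝ → ℝ)
    (hpc : PiecewiseContinuousNonneg f) (hexp : ConformableExpOrder α a f) :
    -- the residue form of the inversion formula
    (∀ (G : ℂ → ℂ) (c : ℝ) (R : ℕ → ℝ),
      Meromorphic G →
      (∀ s : ℂ, a < s.re → G s = conformableLaplace α f s) →
      a < c →
      ContourGrowth G c R →
        (∀ ρ : ℝ, (poleSet G ∩ Metric.ball 0 ρ).Finite) ∧
        ∀ t : ℝ, 0 < t → IsNormalizedAt f t →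
          Tendsto
            (fun n : ℕ => ∑ᶠ z ∈ poleSet G ∩ Metric.ball 0 (R n),
              residueAt (fun s => Complex.exp (s * ((t ^ α / α : ℝ) : ℂ)) * G s) z)
            atTop (𝓝 (f t : ℂ)) ∧
          (Summable (fun z : poleSet G =>
              residueAt (fun s => Complex.exp (s * ((t ^ α / α : ℝ) : ℂ)) * G s) z) →
            HasSum (fun z : poleSet G =>
              residueAt (fun s => Complex.exp (s * ((t ^ α / α : ℝ) : ℂ)) * G s) z)
              (f t : ℂ))) ∧
    -- the example: a transform equal to `1 / (s - b)`
    (∀ b : ℝ, (∀ s : ℂ, a < s.re → conformableLaplace α f s = 1 / (s - b)) →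
      ∀ t : ℝ, 0 < t →
        residueAt (fun s => Complex.exp (s * ((t ^ α / α : ℝ) : ℂ)) * (1 / (s - b))) b =
          Complex.exp (b * ((t ^ α / α : ℝ) : ℂ)) ∧
        (IsNormalizedAt f t → f t = Real.exp (b * (t ^ α / α)))) := by
  refine ⟨fun G c R hG hGF hac hgrowth => ⟨hG.finite_poleSet_inter_ball, fun t ht hn => ?_⟩,
    fun b hF t ht => ⟨residueAt_exp_mul_one_div_sub _ _,
      eq_exp_of_conformableLaplace_eq_one_div_sub hα hpc hexp hF ht⟩⟩
  have hlim := tendsto_finsum_residueAt hα hpc hexp hG hGF hac hgrowth ht hn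
  exact ⟨hlim, hasSum_of_tendsto_finsum_ball hG.finite_poleSet_inter_ball hgrowth.2.1 hlim⟩
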